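/- Notation. Let $\gamma_d$ be the standard Gaussian measure on $\mathbb R^d$. The potential of an activation $\sigma:\mathbb R^d\times\mathbb R^d\to\mathbb R$ is $\Phi(\theta,w)=\mathbb E_{X\sim\gamma_d}[\sigma(X,\theta)\sigma(X,w)]$. For a target network $(b,w)=(b_j,w_j)_{j\le k}$ and parameters $(a,\theta)\in\mathbb R^k\times(\mathbb R^d)^k$ (with the Euclidean norm) the loss (with $a$ re-parametrized to $-a$) and the regularized loss are $$L(a,\theta)=\mathbb E_{X\sim\gamma_d}\Big[\Big(\sum_{i=1}^k a_i\sigma(X,\theta_i)+\sum_{j=1}^k b_j\sigma(X,w_j)\Big)^2\Big],\qquad G(a,\theta)=L(a,\theta)+\|a\|^2 .$$ SecondGD with parameters $\alpha,\eta,\gamma>0$, started at $x_0$, does the following in iteration $i=1,2,\dots$. If $\|\nabla G(x_{i-1})\|\ge\eta$, set $x_i=x_{i-1}-\alpha\nabla G(x_{i-1})$. Otherwise, let $v$ be a unit eigenvector for the smallest eigenvalue $\lambda_{\min}$ of $\nabla^2G(x_{i-1})$ and set $x_i=x_{i-1}-\alpha|\lambda_{\min}|\,\mathrm{sign}(\nabla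 G(x_{i-1})^Tv)\,v$, where $\mathrm{sign}(0)=1$. If $G(x_i)\ge G(x_{i-1})-\min(\alpha\eta^2/2,\alpha^2\gamma^3/2)$, stop and return $x_{i-1}$. Theorem. There are activations $\sigma_\epsilon=\sigma_{d,k,\epsilon}$, one for each $d\equiv 3 \pmod 4$, $k\ge1$ and $\epsilon\in(0,1)$, with the following two properties. (1) $\sigma_\epsilon(x,w)=e^{\|x\|^2/4}h(\|x-w\|)$ for some function $h:\mathbb R\to\mathbb R$; $\sigma_\epsilon(\cdot,w)\in L^2(\gamma_d)$ for all $w$; the potential $\Phi_\epsilon(\theta,w)$ depends only on $\|\theta-w\|$; $\Phi_\epsilon(\theta,\theta)=1$; and wherever $\|\theta-w\|\ge\epsilon$, $\Phi_\epsilon$ is $C^2$ in $\theta$ with $\Delta_\theta\Phi_\epsilon=\Phi_\epsilon$. (2) For all $p\in\mathbb N$ and $c,q\in\mathbb R$ there is a constant $C\in\mathbb N$ such that the following holds for all $d\equiv 3\pmod 4$, $1\le k\le d^p$, $\epsilon\in(0,1)$ and $0<s\le c\,d\log d$. There are $\alpha,\eta,\gamma>0$ and $\theta^{(0)}\in(\mathbb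 R^d)^k$ such that, if $w_1,\dots,w_k\sim\mathcal N(0,sI_d)$ and $b_1,\dots,b_k$ uniform on $[-1,1]$ are all independent, then with probability at least $1-d^{-q}$ there is $a^{(0)}\in\mathbb R^k$ for which SecondGD on $G$ (with activation $\sigma_\epsilon$), started at $(a^{(0)},\theta^{(0)})$, whatever minimal unit eigenvectors it picks (the pick at a point depending only on that point), stops within $(d/\epsilon)^{Cd}$ iterations, $G$ being $C^2$ at $x_0$ and at every later iterate from which an iteration starts, and returns some $(a,\theta)$ with $\|\theta_i-w_j\|<\epsilon$ for some $i,j$. -/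

import Mathlib

open MeasureTheory ProbabilityTheory

noncomputable section

/-! ### Depth-two networks, potentials and losses -/

/-- The potential `Φ(θ, w) = 𝔼[σ(X, θ) σ(X, w)]`, `X` standard Gaussian, of an activation `σ`. -/
def potential {d : ℕ} (σ : EuclideanSpace ℝ (Fin d) → EuclideanSpace ℝ (Fin d) → ℝ)
    (θ w : EuclideanSpace ℝ (Fin d)) : ℝ :=
  ∫ x, σ x θ * σ x w ∂(stdGaussian (EuclideanSpace ℝ (Fin d)))

/-- `σ` is a radial activation (up to the Gaussian weight `exp (‖x‖² / 4)`) with finite second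
moments whose potential is radial, normalized, and `1`-harmonic (`Δ Φ = Φ`) at all distances
`r ≥ ε`. -/
structure IsAlmostHarmonicActivation {d : ℕ} (ε : ℝ)
    (σ : EuclideanSpace ℝ (Fin d) → EuclideanSpace ℝ (Fin d) → ℝ) : Prop where
  radial_activation : ∃ h : ℝ → ℝ, ∀ x w, σ x w = Real.exp (‖x‖ ^ 2 / 4) * h ‖x - w‖
  memLp : ∀ w, MemLp (fun x => σ x w) 2 (stdGaussian (EuclideanSpace ℝ (Fin d)))
  radial_potential : ∃ φ : ℝ → ℝ, ∀ θ w, potential σ θ w = φ ‖θ - w‖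
  normalized : ∀ θ, potential σ θ θ = 1
  harmonic : ∀ θ w, ε ≤ ‖θ - w‖ →
    ContDiffAt ℝ 2 (fun u => potential σ u w) θ ∧
      Laplacian.laplacian (fun u => potential σ u w) θ = potential σ θ w

/-- The parameters `(a, θ)` of a network with `k` hidden units on `ℝᵈ`, with the Euclidean norm
of `ℝᵏ × (ℝᵈ)ᵏ`. -/
abbrev Params (d k : ℕ) : Type :=
  WithLp 2 (EuclideanSpace ℝ (Fin k) × PiLp 2 (fun _ : Fin k => EuclideanSpace ℝ (Fin d)))

/-- The pair `(a, θ)` as a point of the parameter space. -/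
def mkParams {d k : ℕ} (a : Fin k → ℝ) (θ : Fin k → EuclideanSpace ℝ (Fin d)) : Params d k :=
  WithLp.toLp 2 (WithLp.toLp 2 a, WithLp.toLp 2 θ)

/-- The squared loss `L(a, θ)` for the target network `(b, w)`, where `a` has been
re-parametrized to `-a`. -/
def squaredLoss {d k : ℕ} (σ : EuclideanSpace ℝ (Fin d) → EuclideanSpace ℝ (Fin d) → ℝ)
    (w : Fin k → EuclideanSpace ℝ (Fin d)) (b : Fin k → ℝ) (z : Params d k) : ℝ :=
  ∫ x, (∑ i, z.fst i * σ x (z.snd i) + ∑ j, b j * σ x (w j)) ^ 2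
    ∂(stdGaussian (EuclideanSpace ℝ (Fin d)))

/-- The regularized loss `G = L + ‖a‖²`. -/
def regLoss {d k : ℕ} (σ : EuclideanSpace ℝ (Fin d) → EuclideanSpace ℝ (Fin d) → ℝ)
    (w : Fin k → EuclideanSpace ℝ (Fin d)) (b : Fin k → ℝ) (z : Params d k) : ℝ :=
  squaredLoss σ w b z + ‖z.fst‖ ^ 2

/-! ### The descent algorithm -/

section Descent

variable {M : Type*} [NormedAddCommGroup M] [InnerProductSpace ℝ M] [CompleteSpace M]

/-- The Hessian of `f` at `x`, as an operator. -/
def hessian (f : M → ℝ) (x : M) : M →L[ℝ] M :=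
  fderiv ℝ (gradient f) x

/-- The smallest eigenvalue of an operator (meant for symmetric operators in finite dimension). -/
def lambdaMin (H : M →L[ℝ] M) : ℝ :=
  sInf {μ : ℝ | Module.End.HasEigenvalue (H : M →ₗ[ℝ] M) μ}

/-- `v` selects, at every point where `f` is `C²`, a unit eigenvector for the smallest eigenvalue
of the Hessian of `f`. -/
def IsMinEigenvectorRule (f : M → ℝ) (v : M → M) : Prop :=
  ∀ x, ContDiffAt ℝ 2 f x → ‖v x‖ = 1 ∧ hessian f x (v x) = lambdaMin (hessian f x) • v x

/-- The sign of a real number, with value `1` at `0`. -/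
def sgn (t : ℝ) : ℝ := if t < 0 then -1 else 1

/-- One step of Hessian descent, with step size `α` and eigenvector rule `v`: move by
`α |λ_min|` along `v`, in the direction in which `f` does not increase to first order. -/
def hessianStep (f : M → ℝ) (v : M → M) (α : ℝ) (x : M) : M :=
  x + (-(α * |lambdaMin (hessian f x)| * sgn (inner ℝ (gradient f x) (v x)))) • v x

/-- The update made in one iteration of SecondGD: a gradient step if the gradient has norm at
least `η`, a step of Hessian descent otherwise. -/
def secondGDStep (f : M → ℝ) (v : M → M) (α η : ℝ) (x : M) : M :=
  open Classical in
  if η ≤ ‖gradient f x‖ then x - α • gradient f x else hessianStep f v α x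

/-- The iterate `x_m` of SecondGD started at `x₀`, the stopping rule being disregarded. -/
def secondGDIterate (f : M → ℝ) (v : M → M) (α η : ℝ) (x₀ : M) (m : ℕ) : M :=
  (secondGDStep f v α η)^[m] x₀

/-- The stopping test of SecondGD in the iteration that starts at `x`: the update does not decrease
`f` by more than `min (α η² / 2) (α² γ³ / 2)`. -/
def SecondGDStops (f : M → ℝ) (v : M → M) (α η γ : ℝ) (x : M) : Prop :=
  f x - min (α * η ^ 2 / 2) (α ^ 2 * γ ^ 3 / 2) ≤ f (secondGDStep f v α η x)

/-- SecondGD, started at `x₀`, returns `out` in its `N`-th iteration: the stopping test succeeds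
for the first time in iteration `N`, which starts at `x_{N-1} = out`. Moreover `f` is `C²` at
`x_0, …, x_{N-1}`, so that every gradient and Hessian used by the run exists. -/
structure SecondGDReturns (f : M → ℝ) (v : M → M) (α η γ : ℝ) (x₀ : M) (N : ℕ) (out : M) :
    Prop where
  one_le : 1 ≤ N
  smooth : ∀ m < N, ContDiffAt ℝ 2 f (secondGDIterate f v α η x₀ m)
  not_before : ∀ m < N - 1, ¬ SecondGDStops f v α η γ (secondGDIterate f v α η x₀ m)
  stops : SecondGDStops f v α η γ (secondGDIterate f v α η x₀ (N - 1))
  out_eq : out = secondGDIterate f v α η x₀ (N - 1)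

end Descent

/-! ### The random target network -/

/-- The law of `(w, b)` where `w_1, …, w_k ∼ N(0, s I_d)` and `b_1, …, b_k` uniform on `[-1, 1]`
are all independent. -/
def targetLaw (d k : ℕ) (s : ℝ) :
    Measure ((Fin k → EuclideanSpace ℝ (Fin d)) × (Fin k → ℝ)) :=
  (Measure.pi fun _ => multivariateGaussian (0 : EuclideanSpace ℝ (Fin d))
      (s • (1 : Matrix (Fin d) (Fin d) ℝ))).prod
    (Measure.pi fun _ => ProbabilityTheory.cond volume (Set.Icc (-1 : ℝ) 1))

end

/-! The activation comes from a factorization of the resolvent of the Laplacian. If `Y` and `Z` are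
independent standard Gaussians on `ℝ` and `ℝᵈ`, the law ν of `Y • Z` has characteristic function (1
+ ‖t‖²)^(-1/2), so convolution with ν ∗ ν is (1 - Δ)⁻¹ (`integral_sub_laplacian_besselLaw_conv`).
Let β be a smooth radial bump of radius ε/3 and take β ∗ ν as the profile of the activation, the
factor exp(‖x‖²/4) cancelling the Gaussian density. The potential is then a multiple of the
autocorrelation Φ = β ∗ β ∗ ν ∗ ν, and (1 - Δ)Φ is the same multiple of β ∗ β, which vanishes at
distance ε and beyond (`laplacian_besselKernel`). Derivatives of Φ fall on one copy of β and are
bounded; Gaussian estimates give Φ ≥ (d/ε)^(-O(d)) on balls of radius O(d log d)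
(`besselKernel_ge_pow`).

The landscape argument (`lambdaMin_hessian_kernelLoss_le`) compares two quantities. Write P for the
sum of a_i b_j Φ(θ_i - w_j) and Q ≥ 0 for the sum of a_i a_j Φ(θ_i - θ_j). Moving all nodes together
leaves Q unchanged, so the Hessian of G has trace 2P over these directions when no node is within ε
of a target. Rescaling the weights gives the derivative 2Q + 2P + 2‖a‖². If the gradient has norm at
most ‖a‖, then 2P ≤ -‖a‖², hence some translation has negative curvature. An approximate second
order critical point with weights not too small must therefore have a node near a target.

The weights stay away from zero because descent starts below the loss of the zero network: with all
nodes at the origin and one nonzero weight, the start gains S²/2, where S is the sum of b_j Φ(w_j).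
Since b_1 is uniform and Φ(w_1) is bounded below with high probability, |S| is rarely small
(`targetLaw_bad_le`). The usual descent estimates bound the number of iterations
(`exists_secondGDReturns`), and every quantity involved is a power of (d/ε)^d up to the factor k ≤
d^p. -/

noncomputable section

/-! ### A probabilistic square root of the resolvent of the Laplacian -/

section BesselLaw

variable {E : Type*} [NormedAddCommGroup E] [InnerProductSpace ℝ E] [FiniteDimensional ℝ E]
  [MeasurableSpace E] [BorelSpace E]

/-- The density of the standard Gaussian measure. -/
def gaussianDensity (x : E) : ℝ :=
  (2 * Real.pi) ^ (-(Module.finrank ℝ E / 2 : ℝ)) * Real.exp (-‖x‖ ^ 2 / 2)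

lemma gaussianDensity_pos (x : E) : 0 < gaussianDensity x := by
  unfold gaussianDensity; positivity

lemma continuous_gaussianDensity : Continuous (gaussianDensity : E → ℝ) := by
  unfold gaussianDensity; fun_prop

lemma integrable_exp_neg_mul_sq_norm {b : ℝ} (hb : 0 < b) :
    Integrable (fun x : E => Real.exp (-b * ‖x‖ ^ 2)) := by
  have := (GaussianFourier.integrable_cexp_neg_mul_sq_norm_add (V := E)
    (b := (b : ℂ)) (by simpa using hb) 0 0).norm
  refine this.congr (Filter.Eventually.of_forall fun x => ?_)
  simp only [Complex.norm_exp]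
  congr 1
  simp [← Complex.ofReal_pow]

lemma integrable_gaussianDensity : Integrable (gaussianDensity : E → ℝ) := by
  unfold gaussianDensity
  refine Integrable.const_mul ?_ _
  refine (integrable_exp_neg_mul_sq_norm (E := E) (b := 1 / 2) (by norm_num)).congr
    (Filter.Eventually.of_forall fun x => ?_)
  dsimp only; congr 1; ring

/-- Both measures are finite, so comparing characteristic functions suffices; that of the density is
the Gaussian Fourier integral with b = 1/2. -/
theorem stdGaussian_eq_withDensity :
    stdGaussian E = volume.withDensity (fun x => ENNReal.ofReal (gaussianDensity x)) := by
  have hfin : IsFiniteMeasure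
      ((volume : Measure E).withDensity (fun x => ENNReal.ofReal (gaussianDensity x))) :=
    isFiniteMeasure_withDensity_ofReal integrable_gaussianDensity.hasFiniteIntegral
  apply Measure.ext_of_charFun
  ext t
  rw [charFun_stdGaussian, charFun_apply, integral_withDensity_eq_integral_toReal_smul
    (by unfold gaussianDensity; fun_prop) (by simp)]
  have h := GaussianFourier.integral_cexp_neg_mul_sq_norm_add (V := E)
    (b := 1 / 2) (by norm_num) Complex.I t
  have h2 : (Real.pi / (1 / 2) : ℂ) = ((2 * Real.pi : ℝ) : ℂ) := by push_cast; ring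
  have h3 : (((2 * Real.pi) ^ (-(Module.finrank ℝ E / 2 : ℝ)) : ℝ) : ℂ) *
      ((2 * Real.pi : ℝ) : ℂ) ^ ((Module.finrank ℝ E : ℂ) / 2) = 1 := by
    rw [Complex.ofReal_cpow (by positivity), ← Complex.cpow_add _ _ (by
      exact_mod_cast (by positivity : (2 * Real.pi) ≠ 0))]
    push_cast
    simp
  have : ∀ x : E, (ENNReal.ofReal (gaussianDensity x)).toReal •
      Complex.exp ((inner ℝ x t : ℝ) * Complex.I) =
      (((2 * Real.pi) ^ (-(Module.finrank ℝ E / 2 : ℝ)) : ℝ) : ℂ) *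
      Complex.exp (-(1 / 2) * ‖x‖ ^ 2 + Complex.I * (inner ℝ t x : ℝ)) := by
    intro x
    rw [ENNReal.toReal_ofReal (gaussianDensity_pos x).le, gaussianDensity, Complex.real_smul,
      Complex.exp_add, real_inner_comm]
    push_cast
    rw [mul_assoc]
    congr 2
    · congr 1; ring
    · congr 1; ring
  simp_rw [this]
  rw [integral_const_mul, h, h2, ← mul_assoc, h3, one_mul]
  congr 1
  rw [Complex.I_sq]
  ring

theorem integral_stdGaussian {F : Type*} [NormedAddCommGroup F] [NormedSpace ℝ F] (f : E → F) :
    ∫ x, f x ∂(stdGaussian E) = ∫ x, gaussianDensity x • f x := by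
  rw [stdGaussian_eq_withDensity, integral_withDensity_eq_integral_toReal_smul
    (by unfold gaussianDensity; fun_prop) (by simp)]
  simp_rw [ENNReal.toReal_ofReal (gaussianDensity_pos _).le]

variable (E) in
/-- The law of `Y • Z`, with `Y` and `Z` independent standard Gaussians on `ℝ` and `E`; its
characteristic function is `(1 + ‖t‖²)^(-1/2)`. -/
def besselLaw : Measure E :=
  ((gaussianReal 0 1).prod (stdGaussian E)).map (fun p => p.1 • p.2)

instance : IsProbabilityMeasure (besselLaw E) :=
  Measure.isProbabilityMeasure_map (by fun_prop)

theorem integral_besselLaw {F : Type*} [NormedAddCommGroup F] [NormedSpace ℝ F] {f : E → F}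
    (hf : Continuous f) {C : ℝ} (hC : ∀ x, ‖f x‖ ≤ C) :
    ∫ x, f x ∂(besselLaw E) = ∫ y, ∫ z, f (y • z) ∂(stdGaussian E) ∂(gaussianReal 0 1) := by
  rw [besselLaw, integral_map (by fun_prop) hf.aestronglyMeasurable, integral_prod]
  exact (integrable_const C).mono' (by fun_prop) (Filter.Eventually.of_forall fun x => hC _)

/-- Given `Y = y`, the conditional characteristic function is exp(-y²‖t‖²/2), and integrating this
over y is a one-dimensional Gaussian integral. -/
theorem charFun_besselLaw (t : E) :
    charFun (besselLaw E) t = (((√(1 + ‖t‖ ^ 2))⁻¹ : ℝ) : ℂ) := by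
  rw [charFun_apply, integral_besselLaw (C := 1) (by fun_prop) (by simp [Complex.norm_exp])]
  have h1 : ∀ y : ℝ, ∫ z, Complex.exp ((inner ℝ (y • z) t : ℝ) * Complex.I) ∂(stdGaussian E) =
      ((Real.exp (-(‖t‖ ^ 2 / 2) * y ^ 2) : ℝ) : ℂ) := by
    intro y
    have := charFun_stdGaussian (E := E) (y • t)
    rw [charFun_apply] at this
    simp_rw [inner_smul_left, RCLike.conj_to_real]
    simp_rw [inner_smul_right] at this
    rw [this, norm_smul]
    push_cast
    congr 1
    have h2 : ((‖y‖ : ℝ) : ℂ) ^ 2 = (y : ℂ) ^ 2 := by norm_cast; simp [sq_abs]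
    rw [mul_pow, h2]
    ring
  simp_rw [h1]
  rw [integral_complex_ofReal, integral_gaussianReal_eq_integral_smul (by simp)]
  congr 1
  have h2 : ∀ y : ℝ, gaussianPDFReal 0 1 y • Real.exp (-(‖t‖ ^ 2 / 2) * y ^ 2) =
      (√(2 * Real.pi))⁻¹ * Real.exp (-((1 + ‖t‖ ^ 2) / 2) * y ^ 2) := by
    intro y
    simp only [gaussianPDFReal, smul_eq_mul, NNReal.coe_one, mul_one, sub_zero, mul_assoc,
      ← Real.exp_add]
    congr 2
    ring
  simp_rw [h2]
  rw [integral_const_mul, integral_gaussian, ← Real.sqrt_inv, ← Real.sqrt_mul (by positivity),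
    ← Real.sqrt_inv]
  congr 1
  field_simp

theorem charFun_besselLaw_conv (t : E) :
    charFun (besselLaw E ∗ besselLaw E) t = (((1 + ‖t‖ ^ 2)⁻¹ : ℝ) : ℂ) := by
  rw [charFun_conv, charFun_besselLaw, ← Complex.ofReal_mul, ← mul_inv,
    Real.mul_self_sqrt (by positivity)]

open SchwartzMap FourierTransform Laplacian in
/-- Convolving with the law `besselLaw E ∗ besselLaw E` inverts `1 - Δ`. -/
theorem integral_sub_laplacian_besselLaw_conv (f : 𝓢(E, ℂ)) (x : E) :
    ∫ w, (f (x - w) - Δ (f : E → ℂ) (x - w)) ∂(besselLaw E ∗ besselLaw E) = f x := by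
  have hg : (fun ξ : E => ‖ξ‖ ^ 2).HasTemperateGrowth := by fun_prop
  -- `H` is the Fourier transform of f - Δf. The multiplier is written with the norm of -2πξ because
  -- the characteristic function is evaluated there below.
  set H : 𝓢(E, ℂ) := 𝓕 f + (2 * Real.pi) ^ 2 • smulLeftCLM ℂ (fun ξ : E => ‖ξ‖ ^ 2) (𝓕 f) with hH
  have hHξ : ∀ ξ, H ξ = ((1 + ‖(-(2 * Real.pi)) • ξ‖ ^ 2 : ℝ) : ℂ) * 𝓕 f ξ := by
    intro ξ
    have h3 : H ξ = 𝓕 f ξ + (2 * Real.pi) ^ 2 • (‖ξ‖ ^ 2 • 𝓕 f ξ) := by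
      rw [← smulLeftCLM_apply_apply hg]; rfl
    have h4 : ‖(-(2 * Real.pi)) • ξ‖ ^ 2 = (2 * Real.pi) ^ 2 * ‖ξ‖ ^ 2 := by
      rw [norm_smul, mul_pow, Real.norm_eq_abs, sq_abs, neg_sq]
    rw [h3, h4]
    simp only [Complex.real_smul]
    push_cast
    ring
  have h1 : ∀ y, f y - Δ (f : E → ℂ) y =
      ∫ ξ, Complex.exp ((2 * Real.pi * inner ℝ ξ y : ℝ) * Complex.I) * H ξ := by
    intro y
    have h2 : f - Δ f = 𝓕⁻ H := by
      rw [laplacian_eq_fourierMultiplierCLM, fourierMultiplierCLM_apply, hH,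
        FourierTransform.fourierInv_add, FourierTransform.fourierInv_fourier_eq,
        FourierTransform.fourierInv_smul, neg_smul, sub_neg_eq_add]
    have h4 : (f - Δ f) y = f y - Δ (f : E → ℂ) y := by rw [← laplacian_apply]; rfl
    rw [← h4, h2, SchwartzMap.fourierInv_coe, Real.fourierInv_eq']
    rfl
  have h5 : f x = ∫ ξ, Complex.exp ((2 * Real.pi * inner ℝ ξ x : ℝ) * Complex.I) * 𝓕 f ξ := by
    conv_lhs => rw [← FourierTransform.fourierInv_fourier_eq (F := 𝓢(E, ℂ)) f]
    rw [SchwartzMap.fourierInv_coe, Real.fourierInv_eq']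
    rfl
  simp_rw [h1]
  rw [integral_integral_swap, h5]
  · refine integral_congr_ae (Filter.Eventually.of_forall fun ξ => ?_)
    -- Separating the phases turns the integral over w into the characteristic function at -2πξ,
    -- which is the reciprocal of the multiplier in `hHξ`.
    have h6 : ∀ w, Complex.exp ((2 * Real.pi * inner ℝ ξ (x - w) : ℝ) * Complex.I) * H ξ =
        Complex.exp ((inner ℝ w ((-(2 * Real.pi)) • ξ) : ℝ) * Complex.I) *
        (Complex.exp ((2 * Real.pi * inner ℝ ξ x : ℝ) * Complex.I) * H ξ) := by
      intro w
      rw [← mul_assoc, ← Complex.exp_add, inner_sub_right, inner_smul_right,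
        real_inner_comm ξ w]
      congr 2
      push_cast
      ring
    dsimp only
    simp_rw [h6]
    rw [integral_mul_const, ← charFun_apply, charFun_besselLaw_conv, hHξ]
    rw [mul_left_comm, ← mul_assoc (((_)⁻¹ : ℝ) : ℂ), ← Complex.ofReal_mul, inv_mul_cancel₀
      (by positivity), Complex.ofReal_one, one_mul]
  · refine ((integrable_const (1 : ℝ)).mul_prod H.integrable.norm).mono' ?_ ?_
    · refine Continuous.aestronglyMeasurable ?_
      have := H.continuous
      fun_prop
    · refine Filter.Eventually.of_forall fun p => ?_
      simp [Function.uncurry, Complex.norm_exp]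

end BesselLaw

/-! ### Differentiating a convolution with a finite measure -/

section Smoothing

variable {E : Type*} [NormedAddCommGroup E] [NormedSpace ℝ E] [FiniteDimensional ℝ E]
  [MeasurableSpace E] [BorelSpace E] {m : Measure E} [IsFiniteMeasure m] {F : E → ℝ} {n : ℕ} {C : ℝ}

variable (E) in
/-- Currying of the first variable of a multilinear map, as a continuous linear map. -/
def curryLeftCLM (j : ℕ) : (E [×(j + 1)]→L[ℝ] ℝ) →L[ℝ] (E →L[ℝ] E [×j]→L[ℝ] ℝ) :=
  ((continuousMultilinearCurryLeftEquiv ℝ (fun _ : Fin (j + 1) => E) ℝ).toContinuousLinearEquiv :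
    (E [×(j + 1)]→L[ℝ] ℝ) →L[ℝ] (E →L[ℝ] E [×j]→L[ℝ] ℝ))

lemma integrable_iteratedFDeriv_sub (hF : ContDiff ℝ n F)
    (hC : ∀ j ≤ n, ∀ x, ‖iteratedFDeriv ℝ j F x‖ ≤ C) {j : ℕ} (hj : j ≤ n) (x : E) :
    Integrable (fun τ => iteratedFDeriv ℝ j F (x - τ)) m := by
  have hc : Continuous (iteratedFDeriv ℝ j F) := hF.continuous_iteratedFDeriv (by exact_mod_cast hj)
  exact (integrable_const C).mono' (by fun_prop) (Filter.Eventually.of_forall fun τ => hC j hj _)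

/-- Convolving with a finite measure commutes with taking derivatives. -/
theorem hasFTaylorSeriesUpTo_integral_sub (hF : ContDiff ℝ n F)
    (hC : ∀ j ≤ n, ∀ x, ‖iteratedFDeriv ℝ j F x‖ ≤ C) :
    HasFTaylorSeriesUpTo n (fun x => ∫ τ, F (x - τ) ∂m)
      (fun x j => ∫ τ, iteratedFDeriv ℝ j F (x - τ) ∂m) := by
  have hcont : ∀ j ≤ n, Continuous (iteratedFDeriv ℝ j F) := fun j hj =>
    hF.continuous_iteratedFDeriv (by exact_mod_cast hj)
  refine ⟨fun x => ?_, fun j hj x => ?_, fun j hj => ?_⟩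
  · have h := ((continuousMultilinearCurryFin0 ℝ E ℝ).toContinuousLinearEquiv :
      (E [×0]→L[ℝ] ℝ) →L[ℝ] ℝ).integral_comp_comm
      (integrable_iteratedFDeriv_sub (m := m) hF hC (Nat.zero_le _) x)
    refine (Eq.symm h).trans ?_
    simp
  · have hj' : j < n := by exact_mod_cast hj
    -- Differentiation under the integral; the constant `C` dominates because `m` is finite. The
    -- derivative takes values in the curried space, so the integral must afterwards be commuted
    -- with currying.
    have key := hasFDerivAt_integral_of_dominated_of_fderiv_le (μ := m) (𝕜 := ℝ)
      (F := fun x τ => iteratedFDeriv ℝ j F (x - τ))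
      (F' := fun x τ => (iteratedFDeriv ℝ (j + 1) F (x - τ)).curryLeft)
      (x₀ := x) (s := Set.univ) (bound := fun _ => C) Filter.univ_mem
      (Filter.Eventually.of_forall fun y =>
        (integrable_iteratedFDeriv_sub hF hC hj'.le y).aestronglyMeasurable)
      (integrable_iteratedFDeriv_sub hF hC hj'.le x)
      ?_ (Filter.Eventually.of_forall fun τ y _ => ?_) (integrable_const _)
      (Filter.Eventually.of_forall fun τ y _ => ?_)
    · have h := ContinuousLinearMap.integral_comp_comm (𝕜 := ℝ)
        (E := E [×(j + 1)]→L[ℝ] ℝ) (Fₗ := E →L[ℝ] E [×j]→L[ℝ] ℝ) (curryLeftCLM E j)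
        (integrable_iteratedFDeriv_sub (m := m) (j := j + 1) hF hC hj' x)
      have h2 : (∫ τ, iteratedFDeriv ℝ (j + 1) F (x - τ) ∂m).curryLeft =
        ∫ τ, (iteratedFDeriv ℝ (j + 1) F (x - τ)).curryLeft ∂m := h.symm
      change HasFDerivAt _ (∫ τ, iteratedFDeriv ℝ (j + 1) F (x - τ) ∂m).curryLeft x
      rw [h2]
      exact key
    · exact (ContinuousLinearMap.integrable_comp
        (σ := RingHom.id ℝ)
        (H := E [×(j + 1)]→L[ℝ] ℝ) (E := E →L[ℝ] E [×j]→L[ℝ] ℝ) (curryLeftCLM E j)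
        (integrable_iteratedFDeriv_sub (m := m) (j := j + 1) hF hC hj' x)).aestronglyMeasurable
    · rw [ContinuousMultilinearMap.curryLeft_norm]
      exact hC _ (by omega) _
    · have h := (hF.ftaylorSeries).fderiv j hj (y - τ)
      exact h.comp y ((hasFDerivAt_id y).sub_const τ)
  · have hj' : j ≤ n := by exact_mod_cast hj
    refine continuous_of_dominated (bound := fun _ => C) (fun x =>
      (integrable_iteratedFDeriv_sub hF hC hj' x).aestronglyMeasurable)
      (fun x => Filter.Eventually.of_forall fun τ => hC j hj' _) (integrable_const _)
      (Filter.Eventually.of_forall fun τ => ?_)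
    have := hcont j hj'
    fun_prop

theorem contDiff_integral_sub (hF : ContDiff ℝ n F)
    (hC : ∀ j ≤ n, ∀ x, ‖iteratedFDeriv ℝ j F x‖ ≤ C) :
    ContDiff ℝ n (fun x => ∫ τ, F (x - τ) ∂m) :=
  (hasFTaylorSeriesUpTo_integral_sub hF hC).contDiff

theorem iteratedFDeriv_integral_sub (hF : ContDiff ℝ n F)
    (hC : ∀ j ≤ n, ∀ x, ‖iteratedFDeriv ℝ j F x‖ ≤ C) {j : ℕ} (hj : j ≤ n) (x : E) :
    iteratedFDeriv ℝ j (fun x => ∫ τ, F (x - τ) ∂m) x = ∫ τ, iteratedFDeriv ℝ j F (x - τ) ∂m :=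
  ((hasFTaylorSeriesUpTo_integral_sub hF hC).eq_iteratedFDeriv (by exact_mod_cast hj) x).symm

theorem norm_iteratedFDeriv_integral_sub_le (hF : ContDiff ℝ n F)
    (hC : ∀ j ≤ n, ∀ x, ‖iteratedFDeriv ℝ j F x‖ ≤ C) {j : ℕ} (hj : j ≤ n) (x : E) :
    ‖iteratedFDeriv ℝ j (fun x => ∫ τ, F (x - τ) ∂m) x‖ ≤ C * m.real Set.univ := by
  rw [iteratedFDeriv_integral_sub hF hC hj]
  exact norm_integral_le_of_norm_le_const (Filter.Eventually.of_forall fun τ => hC j hj _)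

end Smoothing

/-! ### The Laplacian of such a convolution -/

section SmoothingLaplacian

variable {E : Type*} [NormedAddCommGroup E] [InnerProductSpace ℝ E] [FiniteDimensional ℝ E]
  [MeasurableSpace E] [BorelSpace E] {m : Measure E} [IsFiniteMeasure m] {F : E → ℝ} {C : ℝ}

theorem laplacian_integral_sub (hF : ContDiff ℝ (2 : ℕ) F)
    (hC : ∀ j ≤ 2, ∀ x, ‖iteratedFDeriv ℝ j F x‖ ≤ C) (x : E) :
    Laplacian.laplacian (fun x => ∫ τ, F (x - τ) ∂m) x =
      ∫ τ, Laplacian.laplacian F (x - τ) ∂m := by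
  simp only [InnerProductSpace.laplacian_eq_iteratedFDeriv_stdOrthonormalBasis]
  rw [integral_finsetSum]
  · refine Finset.sum_congr rfl fun i _ => ?_
    rw [iteratedFDeriv_integral_sub hF hC le_rfl]
    exact ContinuousMultilinearMap.integral_apply (integrable_iteratedFDeriv_sub hF hC le_rfl x) _
  · intro i _
    exact (ContinuousMultilinearMap.apply ℝ (fun _ : Fin 2 => E) ℝ _).integrable_comp
      (integrable_iteratedFDeriv_sub hF hC le_rfl x)

end SmoothingLaplacian

/-! ### Radial bump functions with dimension-free derivative bounds -/

section Bump

/-- A smooth function on `ℝ` equal to `1` on `(-∞, 1/2]` and to `0` on `[1, ∞)`. -/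
def cutoff (t : ℝ) : ℝ := Real.smoothTransition (2 - 2 * t)

lemma contDiff_cutoff {n : ℕ∞} : ContDiff ℝ n cutoff := by
  unfold cutoff
  exact Real.smoothTransition.contDiff.comp (by fun_prop)

lemma cutoff_nonneg (t : ℝ) : 0 ≤ cutoff t := Real.smoothTransition.nonneg _

lemma cutoff_le_one (t : ℝ) : cutoff t ≤ 1 := Real.smoothTransition.le_one _

lemma cutoff_eq_zero {t : ℝ} (ht : 1 ≤ t) : cutoff t = 0 :=
  Real.smoothTransition.zero_of_nonpos (by linarith)

lemma cutoff_eq_one {t : ℝ} (ht : t ≤ 1 / 2) : cutoff t = 1 :=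
  Real.smoothTransition.one_of_one_le (by linarith)

lemma exists_cutoff_bound : ∃ A : ℝ, 1 ≤ A ∧ ∀ j ≤ 3, ∀ t ∈ Set.Icc (0 : ℝ) 2,
    ‖iteratedFDeriv ℝ j cutoff t‖ ≤ A := by
  have h : ∀ j : ℕ, ∃ A : ℝ, ∀ t ∈ Set.Icc (0 : ℝ) 2, ‖iteratedFDeriv ℝ j cutoff t‖ ≤ A := by
    intro j
    have hc : Continuous (iteratedFDeriv ℝ j cutoff) :=
      (contDiff_cutoff (n := ⊤)).continuous_iteratedFDeriv (by exact_mod_cast le_top)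
    exact isCompact_Icc.exists_bound_of_continuousOn hc.continuousOn
  choose A hA using h
  refine ⟨1 + ∑ j ∈ Finset.range 4, |A j|, by
    have := Finset.sum_nonneg fun j (_ : j ∈ Finset.range 4) => abs_nonneg (A j)
    linarith, fun j hj t ht => ?_⟩
  have h1 := Finset.single_le_sum (f := fun j => |A j|) (fun j _ => abs_nonneg (A j))
    (Finset.mem_range.2 (show j < 4 by omega))
  have h2 := hA j t ht
  have h3 := le_abs_self (A j)
  linarith

variable {E : Type*} [NormedAddCommGroup E] [InnerProductSpace ℝ E]

/-- The first derivative is linear of norm at most 2, so orders above two vanish. The form `3 ^ j`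
is the one required by the bound for derivatives of a composition. -/
lemma norm_iteratedFDeriv_norm_sq_le {x : E} (hx : ‖x‖ ^ 2 ≤ 2) {j : ℕ} (hj : 1 ≤ j) :
    ‖iteratedFDeriv ℝ j (fun y : E => ‖y‖ ^ 2) x‖ ≤ 3 ^ j := by
  set T : E →L[ℝ] E →L[ℝ] ℝ := (2 : ℝ) • innerSL ℝ with hT
  have hf : fderiv ℝ (fun y : E => ‖y‖ ^ 2) = ⇑T := by
    ext y v
    simp [hT, fderiv_norm_sq_apply]
    rfl
  have hn : ‖T‖ ≤ 2 := by
    refine ContinuousLinearMap.opNorm_le_bound₂ _ (by norm_num) fun y v => ?_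
    have h : T y v = 2 * inner ℝ y v := rfl
    rw [h, norm_mul, mul_assoc]
    exact mul_le_mul (by norm_num) (norm_inner_le_norm y v) (norm_nonneg _) (by norm_num)
  obtain ⟨i, rfl⟩ : ∃ i, j = i + 1 := ⟨j - 1, by omega⟩
  rw [← norm_iteratedFDeriv_fderiv, hf]
  match i with
  | 0 =>
    rw [norm_iteratedFDeriv_zero]
    have h1 := T.le_opNorm x
    have h2 : ‖x‖ ≤ 3 / 2 := by nlinarith [norm_nonneg x]
    calc ‖T x‖ ≤ 2 * (3 / 2) := h1.trans (by gcongr)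
      _ = 3 ^ (0 + 1) := by norm_num
  | 1 =>
    rw [norm_iteratedFDeriv_one, ContinuousLinearMap.fderiv]
    exact hn.trans (by norm_num)
  | (i + 2) =>
    rw [← norm_iteratedFDeriv_fderiv]
    have h : fderiv ℝ ⇑T = fun _ => T := funext fun _ => T.fderiv
    rw [h, iteratedFDeriv_const_of_ne (Nat.succ_ne_zero i)]
    simp

/-- A smooth radial bump function at scale `ε`. -/
def bumpFn (ε : ℝ) (x : E) : ℝ := cutoff (‖(3 / ε) • x‖ ^ 2)

variable {ε : ℝ}

lemma contDiff_bumpFn {n : ℕ∞} : ContDiff ℝ n (bumpFn ε : E → ℝ) := by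
  unfold bumpFn
  exact contDiff_cutoff.comp ((contDiff_const_smul _).norm_sq ℝ)

@[fun_prop]
lemma continuous_bumpFn : Continuous (bumpFn ε : E → ℝ) :=
  (contDiff_bumpFn (n := 0)).continuous

lemma bumpFn_nonneg (x : E) : 0 ≤ bumpFn ε x := cutoff_nonneg _

lemma bumpFn_le_one (x : E) : bumpFn ε x ≤ 1 := cutoff_le_one _

/-- The radius ε/3 makes the convolution of two bumps vanish at distance ε and beyond. -/
lemma bumpFn_eq_zero (hε : 0 < ε) {x : E} (hx : ε / 3 ≤ ‖x‖) : bumpFn ε x = 0 := by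
  refine cutoff_eq_zero ?_
  rw [norm_smul, Real.norm_eq_abs, abs_of_pos (by positivity)]
  have : 1 ≤ 3 / ε * ‖x‖ := by
    rw [div_mul_eq_mul_div, one_le_div hε]; linarith
  nlinarith

lemma bumpFn_eq_one (hε : 0 < ε) {x : E} (hx : ‖x‖ ≤ ε / 5) : bumpFn ε x = 1 := by
  refine cutoff_eq_one ?_
  rw [norm_smul, Real.norm_eq_abs, abs_of_pos (by positivity)]
  have h : 3 / ε * ‖x‖ ≤ 3 / 5 := by
    rw [div_mul_eq_mul_div, div_le_iff₀ hε]; linarith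
  have : 0 ≤ 3 / ε * ‖x‖ := by positivity
  nlinarith

lemma bumpFn_congr {x y : E} (h : ‖x‖ = ‖y‖) : bumpFn ε x = bumpFn ε y := by
  simp [bumpFn, norm_smul, h]

lemma hasCompactSupport_bumpFn [FiniteDimensional ℝ E] (hε : 0 < ε) :
    HasCompactSupport (bumpFn ε : E → ℝ) := by
  have := FiniteDimensional.proper_real E
  refine HasCompactSupport.of_support_subset_isCompact (isCompact_closedBall (0 : E) (ε / 3)) ?_
  intro x hx
  by_contra h
  exact hx (bumpFn_eq_zero hε (by simpa using (not_le.1 (by simpa using h)).le))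

/-- The derivatives of the bump functions are bounded independently of the dimension. -/
theorem exists_bumpFn_bound : ∃ A : ℝ, 1 ≤ A ∧ ∀ (d : ℕ) (ε : ℝ), 0 < ε → ε < 1 →
    ∀ j ≤ 3, ∀ x : EuclideanSpace ℝ (Fin d),
      ‖iteratedFDeriv ℝ j (bumpFn ε : EuclideanSpace ℝ (Fin d) → ℝ) x‖ ≤ A / ε ^ 3 := by
  obtain ⟨A, hA1, hA⟩ := exists_cutoff_bound
  refine ⟨6 * A * 27 * 27, by linarith, fun d ε hε hε1 j hj x => ?_⟩
  set N : EuclideanSpace ℝ (Fin d) → ℝ := fun y => cutoff (‖y‖ ^ 2) with hN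
  have hNd : ContDiff ℝ 3 N := contDiff_cutoff.comp (contDiff_norm_sq ℝ)
  have hNb : ∀ y, ‖iteratedFDeriv ℝ j N y‖ ≤ 6 * A * 27 := by
    intro y
    rcases le_or_gt (‖y‖ ^ 2) 2 with hy | hy
    · have h := norm_iteratedFDeriv_comp_le (𝕜 := ℝ) (g := cutoff)
        (f := fun y : EuclideanSpace ℝ (Fin d) => ‖y‖ ^ 2) (n := j) (N := 3) contDiff_cutoff
        (contDiff_norm_sq ℝ) (by exact_mod_cast hj) y (C := A) (D := 3)
        (fun i hi => hA i (hi.trans hj) _ ⟨by positivity, hy⟩)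
        (fun i hi _ => norm_iteratedFDeriv_norm_sq_le hy hi)
      refine h.trans ?_
      have h1 : (j.factorial : ℝ) ≤ 6 := by
        exact_mod_cast (Nat.factorial_le hj).trans (by decide)
      have h2 : (3 : ℝ) ^ j ≤ 27 := by
        calc (3 : ℝ) ^ j ≤ 3 ^ 3 := pow_le_pow_right₀ (by norm_num) hj
          _ = 27 := by norm_num
      gcongr
    · have h : Filter.EventuallyEq (nhds y) N fun _ => 0 := by
        have : ∀ᶠ z in nhds y, 2 < ‖z‖ ^ 2 :=
          (continuous_norm.pow 2).continuousAt.eventually (lt_mem_nhds hy)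
        filter_upwards [this] with z hz
        exact cutoff_eq_zero (by linarith)
      rw [Filter.EventuallyEq.eq_of_nhds (Filter.EventuallyEq.iteratedFDeriv ℝ h j)]
      have : iteratedFDeriv ℝ j (fun _ : EuclideanSpace ℝ (Fin d) => (0 : ℝ)) y = 0 := by
        rw [iteratedFDeriv_fun_zero]; rfl
      rw [this, norm_zero]
      positivity
  set L : EuclideanSpace ℝ (Fin d) →L[ℝ] EuclideanSpace ℝ (Fin d) :=
    (3 / ε) • ContinuousLinearMap.id ℝ _
  have hL : ‖L‖ ≤ 3 / ε := by
    rw [norm_smul, Real.norm_eq_abs, abs_of_pos (by positivity)]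
    exact mul_le_of_le_one_right (by positivity) ContinuousLinearMap.norm_id_le
  have heq : (bumpFn ε : EuclideanSpace ℝ (Fin d) → ℝ) = N ∘ L := rfl
  rw [heq, L.iteratedFDeriv_comp_right hNd x (by exact_mod_cast hj)]
  refine (ContinuousMultilinearMap.norm_compContinuousLinearMap_le _ _).trans ?_
  rw [Finset.prod_const, Finset.card_univ, Fintype.card_fin]
  have h3 : ‖L‖ ^ j ≤ 27 / ε ^ 3 := by
    have h4 : (1 : ℝ) ≤ 3 / ε := by rw [one_le_div hε]; linarith
    calc ‖L‖ ^ j ≤ (3 / ε) ^ j := by gcongr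
      _ ≤ (3 / ε) ^ 3 := pow_le_pow_right₀ h4 hj
      _ = 27 / ε ^ 3 := by rw [div_pow]; norm_num
  calc _ ≤ (6 * A * 27) * (27 / ε ^ 3) := by
        gcongr
        exact hNb _
    _ = _ := by ring

end Bump

/-! ### Crude volume bounds for balls by comparison with cubes -/

section Volume

variable {d : ℕ}

lemma euclideanNorm_le_of_forall_abs_le {x : EuclideanSpace ℝ (Fin d)} {r : ℝ} (hr : 0 ≤ r)
    (h : ∀ i, |x i| ≤ r / d) : ‖x‖ ≤ r := by
  rw [EuclideanSpace.norm_eq]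
  refine Real.sqrt_le_iff.2 ⟨hr, ?_⟩
  calc ∑ i, ‖x i‖ ^ 2 ≤ ∑ _i : Fin d, (r / d) ^ 2 := by
        refine Finset.sum_le_sum fun i _ => ?_
        rw [Real.norm_eq_abs]
        exact pow_le_pow_left₀ (abs_nonneg _) (h i) 2
    _ = d * (r / d) ^ 2 := by simp
    _ ≤ r ^ 2 := by
        rcases Nat.eq_zero_or_pos d with rfl | hd
        · simpa using sq_nonneg r
        · have : (1 : ℝ) ≤ d := by exact_mod_cast hd
          rw [div_pow, mul_div_assoc', div_le_iff₀ (by positivity)]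
          nlinarith [sq_nonneg r, mul_nonneg (sq_nonneg r) (sub_nonneg.2 this)]

lemma volume_real_euclideanClosedBall_ge {r : ℝ} (hr : 0 ≤ r) :
    (2 * r / d) ^ d ≤ (volume : Measure (EuclideanSpace ℝ (Fin d))).real
    (Metric.closedBall 0 r) := by
  have h := (PiLp.volume_preserving_toLp (Fin d)).measure_preimage
    (Metric.isClosed_closedBall (x := (0 : EuclideanSpace ℝ (Fin d)))
    (ε := r)).measurableSet.nullMeasurableSet
  have h2 : Metric.closedBall (0 : Fin d → ℝ) (r / d) ⊆
      (WithLp.toLp 2) ⁻¹' (Metric.closedBall (0 : EuclideanSpace ℝ (Fin d)) r) := by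
    intro x hx
    rw [mem_closedBall_zero_iff] at hx
    simp only [Set.mem_preimage, mem_closedBall_zero_iff]
    exact euclideanNorm_le_of_forall_abs_le hr fun i => (norm_le_pi_norm x i).trans hx
  have h3 := measure_mono (μ := volume) h2
  rw [h, Real.volume_pi_closedBall _ (by positivity)] at h3
  rw [measureReal_def]
  refine (ENNReal.ofReal_le_iff_le_toReal measure_closedBall_lt_top.ne).1 ?_
  refine le_trans (le_of_eq ?_) h3
  simp [mul_div_assoc]

lemma volume_real_euclideanClosedBall_le {r : ℝ} (hr : 0 ≤ r) :
    (volume : Measure (EuclideanSpace ℝ (Fin d))).real (Metric.closedBall 0 r) ≤ (2 * r) ^ d := by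
  have h := (PiLp.volume_preserving_toLp (Fin d)).measure_preimage
    (Metric.isClosed_closedBall (x := (0 : EuclideanSpace ℝ (Fin d)))
    (ε := r)).measurableSet.nullMeasurableSet
  have h2 : (WithLp.toLp 2) ⁻¹' (Metric.closedBall (0 : EuclideanSpace ℝ (Fin d)) r) ⊆
      Metric.closedBall (0 : Fin d → ℝ) r := by
    intro x hx
    simp only [Set.mem_preimage, mem_closedBall_zero_iff] at hx
    rw [mem_closedBall_zero_iff, pi_norm_le_iff_of_nonneg hr]
    intro i
    exact (PiLp.norm_apply_le (WithLp.toLp 2 x : EuclideanSpace ℝ (Fin d)) i).trans hx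
  have h3 := measure_mono (μ := volume) h2
  rw [h, Real.volume_pi_closedBall _ (by positivity)] at h3
  rw [measureReal_def]
  refine ENNReal.toReal_le_of_le_ofReal (by positivity) ?_
  simpa using h3

end Volume

/-! ### The profile, its autocorrelation, and the equation ΔΦ = Φ -/

section Profile

variable {E : Type*} [NormedAddCommGroup E] [InnerProductSpace ℝ E] [FiniteDimensional ℝ E]
  [MeasurableSpace E] [BorelSpace E] {ε : ℝ}

lemma norm_bumpFn_le_one (x : E) : ‖bumpFn ε x‖ ≤ 1 := by
  rw [Real.norm_eq_abs, abs_of_nonneg (bumpFn_nonneg x)]; exact bumpFn_le_one x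

lemma integrable_bumpFn (hε : 0 < ε) : Integrable (bumpFn ε : E → ℝ) :=
  continuous_bumpFn.integrable_of_hasCompactSupport (hasCompactSupport_bumpFn hε)

/-- The bump function convolved with the law `besselLaw E`. -/
def besselProfile (ε : ℝ) (x : E) : ℝ := ∫ w, bumpFn ε (x - w) ∂(besselLaw E)

@[fun_prop]
lemma continuous_besselProfile : Continuous (besselProfile ε : E → ℝ) := by
  unfold besselProfile
  refine continuous_of_dominated (bound := fun _ => 1) (fun x => ?_)
    (fun x => Filter.Eventually.of_forall fun w => norm_bumpFn_le_one _) (integrable_const _)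
    (Filter.Eventually.of_forall fun w => ?_)
  · exact (continuous_bumpFn.comp (continuous_const.sub continuous_id)).aestronglyMeasurable
  · exact continuous_bumpFn.comp (continuous_id.sub continuous_const)

lemma besselProfile_nonneg (x : E) : 0 ≤ besselProfile ε x :=
  integral_nonneg fun _ => bumpFn_nonneg _

lemma norm_besselProfile_le_one (x : E) : ‖besselProfile ε x‖ ≤ 1 := by
  refine (norm_integral_le_of_norm_le_const (C := 1)
    (Filter.Eventually.of_forall fun w => norm_bumpFn_le_one _)).trans ?_
  simp

lemma besselProfile_le_one (x : E) : besselProfile ε x ≤ 1 :=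
  (le_abs_self _).trans (norm_besselProfile_le_one x)

lemma besselProfile_eq (x : E) : besselProfile ε x =
    ∫ y, ∫ z, bumpFn ε (x - y • z) ∂(stdGaussian E) ∂(gaussianReal 0 1) :=
  integral_besselLaw (continuous_bumpFn.comp (continuous_const.sub continuous_id))
    fun _ => norm_bumpFn_le_one _

/-- The bump is radial and the standard Gaussian is invariant under linear isometries. -/
lemma besselProfile_isometry (R : E ≃ₗᵢ[ℝ] E) (x : E) :
    besselProfile ε (R x) = besselProfile ε x := by
  rw [besselProfile_eq, besselProfile_eq]
  refine integral_congr_ae (Filter.Eventually.of_forall fun y => ?_)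
  dsimp only
  conv_lhs => rw [← stdGaussian_map R]
  rw [integral_map (by fun_prop) (Continuous.aestronglyMeasurable (by fun_prop))]
  refine integral_congr_ae (Filter.Eventually.of_forall fun z => ?_)
  refine bumpFn_congr ?_
  rw [← R.map_smul, ← R.map_sub, R.norm_map]

lemma exists_linearIsometryEquiv_of_norm_eq {x y : E} (h : ‖x‖ = ‖y‖) :
    ∃ R : E ≃ₗᵢ[ℝ] E, R x = y :=
  ⟨(ℝ ∙ (x - y))ᗮ.reflection, Submodule.reflection_sub h⟩

lemma besselProfile_congr {x y : E} (h : ‖x‖ = ‖y‖) : besselProfile ε x = besselProfile ε y := by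
  obtain ⟨R, rfl⟩ := exists_linearIsometryEquiv_of_norm_eq h
  exact (besselProfile_isometry R x).symm

lemma integrable_prod_bumpFn_sub (hε : 0 < ε) : Integrable
    (fun p : E × E => bumpFn ε (p.1 - p.2)) ((volume : Measure E).prod (besselLaw E)) := by
  rw [integrable_prod_iff' (Continuous.aestronglyMeasurable (by fun_prop))]
  refine ⟨Filter.Eventually.of_forall fun w => (integrable_bumpFn hε).comp_sub_right w, ?_⟩
  have : ∀ w : E, ∫ x : E, ‖bumpFn ε (x - w)‖ = ∫ x : E, ‖bumpFn ε x‖ := fun w =>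
    integral_sub_right_eq_self (fun x => ‖bumpFn ε x‖) w
  simp only [this]
  exact integrable_const _

lemma integrable_besselProfile (hε : 0 < ε) : Integrable (besselProfile ε : E → ℝ) :=
  (integrable_prod_bumpFn_sub hε).integral_prod_left

lemma integral_besselProfile (hε : 0 < ε) :
    ∫ x : E, besselProfile ε x = ∫ x : E, bumpFn ε x := by
  unfold besselProfile
  rw [integral_integral_swap (f := fun x w => bumpFn ε (x - w)) (integrable_prod_bumpFn_sub hε)]
  simp [integral_sub_right_eq_self (fun x : E => bumpFn ε x)]

/-- Fubini and the translation by w move the convolution with `besselLaw` from the profile to the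
test function. Applied to another profile, this brings the two Bessel factors together. -/
lemma integral_besselProfile_mul (hε : 0 < ε) {g : E → ℝ} (hg : Continuous g) {C : ℝ}
    (hC : ∀ x, ‖g x‖ ≤ C) :
    ∫ x : E, besselProfile ε x * g x = ∫ x : E, bumpFn ε x * ∫ w, g (x + w) ∂(besselLaw E) := by
  have h1 : ∀ x : E, besselProfile ε x * g x = ∫ w, bumpFn ε (x - w) * g x ∂(besselLaw E) :=
    fun x => (integral_mul_const _ _).symm
  have h2 : ∀ x : E, bumpFn ε x * ∫ w, g (x + w) ∂(besselLaw E) =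
      ∫ w, bumpFn ε x * g (x + w) ∂(besselLaw E) := fun x => (integral_const_mul _ _).symm
  simp_rw [h1, h2]
  rw [integral_integral_swap (f := fun x w => bumpFn ε (x - w) * g x),
    integral_integral_swap (f := fun x w => bumpFn ε x * g (x + w))]
  · refine integral_congr_ae (Filter.Eventually.of_forall fun w => ?_)
    dsimp only
    rw [← integral_add_right_eq_self (fun x => bumpFn ε (x - w) * g x) w]
    simp
  · refine Integrable.mono' (((integrable_bumpFn (E := E) hε).norm.mul_const C).comp_fst
      (besselLaw E)) ?_ ?_
    · refine Continuous.aestronglyMeasurable ?_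
      unfold Function.uncurry
      fun_prop
    · refine Filter.Eventually.of_forall fun p => ?_
      simp only [Function.uncurry, norm_mul]
      exact mul_le_mul_of_nonneg_left (hC _) (norm_nonneg _)
  · refine Integrable.mono' ((integrable_prod_bumpFn_sub (E := E) hε).norm.mul_const C) ?_ ?_
    · refine Continuous.aestronglyMeasurable ?_
      unfold Function.uncurry
      fun_prop
    · refine Filter.Eventually.of_forall fun p => ?_
      simp only [Function.uncurry, norm_mul]
      exact mul_le_mul_of_nonneg_left (hC _) (norm_nonneg _)

/-- The autocorrelation of `besselProfile`: an unnormalized potential. -/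
def besselKernel (ε : ℝ) (y : E) : ℝ := ∫ x : E, besselProfile ε x * besselProfile ε (x - y)

lemma besselKernel_congr {x y : E} (h : ‖x‖ = ‖y‖) : besselKernel ε x = besselKernel ε y := by
  obtain ⟨R, rfl⟩ := exists_linearIsometryEquiv_of_norm_eq h
  unfold besselKernel
  conv_rhs => rw [← R.measurePreserving.integral_comp R.toHomeomorph.measurableEmbedding]
  simp_rw [← R.map_sub, besselProfile_isometry]

variable (E) in
/-- The finite measure with which the bump function is convolved to give `besselKernel`. -/
def kernelMeasure (ε : ℝ) : Measure E :=
  ((volume : Measure E).withDensity fun x => ENNReal.ofReal (bumpFn ε x)) ∗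
    (besselLaw E ∗ besselLaw E)

lemma isFiniteMeasure_withDensity_bumpFn (hε : 0 < ε) : IsFiniteMeasure
    ((volume : Measure E).withDensity fun x => ENNReal.ofReal (bumpFn ε x)) :=
  isFiniteMeasure_withDensity_ofReal (integrable_bumpFn hε).hasFiniteIntegral

lemma isFiniteMeasure_kernelMeasure (hε : 0 < ε) : IsFiniteMeasure (kernelMeasure E ε) := by
  have := isFiniteMeasure_withDensity_bumpFn (E := E) hε
  unfold kernelMeasure; infer_instance

lemma integral_kernelMeasure (hε : 0 < ε) {g : E → ℝ} (hg : Continuous g) {C : ℝ}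
    (hC : ∀ x, ‖g x‖ ≤ C) : ∫ τ, g τ ∂(kernelMeasure E ε) =
      ∫ x : E, bumpFn ε x * ∫ w, g (x + w) ∂(besselLaw E ∗ besselLaw E) := by
  have := isFiniteMeasure_withDensity_bumpFn (E := E) hε
  unfold kernelMeasure
  rw [integral_conv ((integrable_const C).mono' hg.aestronglyMeasurable
      (Filter.Eventually.of_forall hC)), integral_withDensity_eq_integral_toReal_smul
      (continuous_bumpFn.measurable.ennreal_ofReal) (by simp)]
  simp_rw [ENNReal.toReal_ofReal (bumpFn_nonneg _), smul_eq_mul]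

/-- Since the profile is even, its autocorrelation is its convolution square, made of two bumps and
two Bessel laws. One bump is kept outside the measure: it carries all derivatives, while everything
else is a finite measure. -/
lemma integral_kernelMeasure_sub (hε : 0 < ε) (y : E) :
    ∫ τ, bumpFn ε (y - τ) ∂(kernelMeasure E ε) = besselKernel ε y := by
  rw [integral_kernelMeasure hε (C := 1) (g := fun τ => bumpFn ε (y - τ))
    (by fun_prop) fun _ => norm_bumpFn_le_one _]
  have h1 : besselKernel ε y = ∫ x : E, besselProfile ε x * besselProfile ε (y - x) := by
    unfold besselKernel
    refine integral_congr_ae (Filter.Eventually.of_forall fun x => ?_)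
    dsimp only
    rw [besselProfile_congr (norm_sub_rev x y)]
  rw [h1, integral_besselProfile_mul hε (g := fun x => besselProfile ε (y - x))
    (by fun_prop) fun _ => norm_besselProfile_le_one _]
  refine integral_congr_ae (Filter.Eventually.of_forall fun x => ?_)
  dsimp only
  congr 1
  rw [integral_conv ((integrable_const (1 : ℝ)).mono'
    (Continuous.aestronglyMeasurable (by fun_prop))
      (Filter.Eventually.of_forall fun _ => norm_bumpFn_le_one _))]
  refine integral_congr_ae (Filter.Eventually.of_forall fun w => ?_)
  simp only [besselProfile, sub_sub, add_assoc]

lemma kernelMeasure_real_univ (hε : 0 < ε) :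
    (kernelMeasure E ε).real Set.univ = ∫ x : E, bumpFn ε x := by
  have h := integral_kernelMeasure (E := E) hε (g := fun _ => 1) continuous_const (C := 1) (by simp)
  simpa using h

theorem besselKernel_eq_integral_kernelMeasure (hε : 0 < ε) :
    (besselKernel ε : E → ℝ) = fun y => ∫ τ, bumpFn ε (y - τ) ∂(kernelMeasure E ε) :=
  funext fun y => (integral_kernelMeasure_sub hε y).symm

theorem contDiff_besselKernel (hε : 0 < ε) {n : ℕ} {C : ℝ}
    (hC : ∀ j ≤ n, ∀ x : E, ‖iteratedFDeriv ℝ j (bumpFn ε : E → ℝ) x‖ ≤ C) :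
    ContDiff ℝ n (besselKernel ε : E → ℝ) := by
  have := isFiniteMeasure_kernelMeasure (E := E) hε
  rw [besselKernel_eq_integral_kernelMeasure hε]
  exact contDiff_integral_sub contDiff_bumpFn hC

theorem norm_iteratedFDeriv_besselKernel_le (hε : 0 < ε) {n : ℕ} {C : ℝ}
    (hC : ∀ j ≤ n, ∀ x : E, ‖iteratedFDeriv ℝ j (bumpFn ε : E → ℝ) x‖ ≤ C) {j : ℕ} (hj : j ≤ n)
    (y : E) : ‖iteratedFDeriv ℝ j (besselKernel ε : E → ℝ) y‖ ≤ C * ∫ x : E, bumpFn ε x := by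
  have := isFiniteMeasure_kernelMeasure (E := E) hε
  rw [besselKernel_eq_integral_kernelMeasure hε, ← kernelMeasure_real_univ hε]
  exact norm_iteratedFDeriv_integral_sub_le contDiff_bumpFn hC hj y

/-- A smooth compactly supported function is, after complexification, a Schwartz function, so the
inversion of 1 - Δ applies. -/
lemma integral_sub_laplacian_bumpFn (hε : 0 < ε) (x : E) :
    ∫ w, (bumpFn ε (x - w) - Laplacian.laplacian (bumpFn ε : E → ℝ) (x - w))
      ∂(besselLaw E ∗ besselLaw E) = bumpFn ε x := by
  have hs : ContDiff ℝ (⊤ : ℕ∞) (fun x : E => ((bumpFn ε x : ℝ) : ℂ)) :=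
    Complex.ofRealCLM.contDiff.comp contDiff_bumpFn
  have hc : HasCompactSupport (fun x : E => ((bumpFn ε x : ℝ) : ℂ)) :=
    (hasCompactSupport_bumpFn hε).comp_left (g := fun t : ℝ => (t : ℂ)) Complex.ofReal_zero
  have h := integral_sub_laplacian_besselLaw_conv (hc.toSchwartzMap hs) x
  have h1 : (hc.toSchwartzMap hs : E → ℂ) = fun x => ((bumpFn ε x : ℝ) : ℂ) := rfl
  have h2 : ∀ z, Laplacian.laplacian (fun x : E => ((bumpFn ε x : ℝ) : ℂ)) z =
      ((Laplacian.laplacian (bumpFn ε : E → ℝ) z : ℝ) : ℂ) := by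
    intro z
    exact ContDiffAt.laplacian_CLM_comp_left (l := Complex.ofRealCLM)
      (contDiff_bumpFn (n := 2)).contDiffAt
  rw [h1] at h
  simp only [h2, ← Complex.ofReal_sub] at h
  rw [integral_complex_ofReal] at h
  exact_mod_cast h

/-- Applying 1 - Δ cancels the two Bessel laws and leaves the integral of β(x) β(y - x). If ‖y‖ ≥ ε,
then x or y - x has norm at least ε/3, so the integrand vanishes. -/
theorem laplacian_besselKernel (hε : 0 < ε) {y : E} (hy : ε ≤ ‖y‖) {C : ℝ}
    (hC : ∀ j ≤ 2, ∀ x : E, ‖iteratedFDeriv ℝ j (bumpFn ε : E → ℝ) x‖ ≤ C) :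
    Laplacian.laplacian (besselKernel ε : E → ℝ) y = besselKernel ε y := by
  have := isFiniteMeasure_kernelMeasure (E := E) hε
  have hlc : Continuous (Laplacian.laplacian (bumpFn ε : E → ℝ)) := by
    rw [InnerProductSpace.laplacian_eq_iteratedFDeriv_stdOrthonormalBasis]
    refine continuous_finsetSum _ fun i _ => ?_
    have := (contDiff_bumpFn (E := E) (ε := ε) (n := 2)).continuous_iteratedFDeriv (m := 2) le_rfl
    exact (ContinuousMultilinearMap.apply ℝ (fun _ : Fin 2 => E) ℝ _).continuous.comp this
  have hlz : HasCompactSupport (Laplacian.laplacian (bumpFn ε : E → ℝ)) := by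
    rw [InnerProductSpace.laplacian_eq_iteratedFDeriv_stdOrthonormalBasis]
    exact ((hasCompactSupport_bumpFn (E := E) hε).iteratedFDeriv (𝕜 := ℝ) 2).comp_left
      (g := fun T : E [×2]→L[ℝ] ℝ => ∑ i, T ![stdOrthonormalBasis ℝ E i, stdOrthonormalBasis ℝ E i])
      (by simp)
  obtain ⟨D, hD⟩ := hlc.bounded_above_of_compact_support hlz
  rw [besselKernel_eq_integral_kernelMeasure hε,
    laplacian_integral_sub (contDiff_bumpFn (n := 2)) hC]
  have hi1 : Integrable (fun τ => bumpFn ε (y - τ)) (kernelMeasure E ε) :=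
    (integrable_const (1 : ℝ)).mono' (Continuous.aestronglyMeasurable (by fun_prop))
      (Filter.Eventually.of_forall fun _ => norm_bumpFn_le_one _)
  have hi2 : Integrable (fun τ => Laplacian.laplacian (bumpFn ε : E → ℝ) (y - τ))
      (kernelMeasure E ε) :=
    (integrable_const D).mono' (hlc.comp (by fun_prop)).aestronglyMeasurable
      (Filter.Eventually.of_forall fun _ => hD _)
  rw [eq_comm, ← sub_eq_zero, ← integral_sub hi1 hi2,
    integral_kernelMeasure hε (C := 1 + D)
      (g := fun τ => bumpFn ε (y - τ) - Laplacian.laplacian (bumpFn ε : E → ℝ) (y - τ))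
      (Continuous.sub (by fun_prop) (hlc.comp (by fun_prop)))
      (fun τ => (norm_sub_le _ _).trans (add_le_add (norm_bumpFn_le_one _) (hD _)))]
  simp_rw [← sub_sub, integral_sub_laplacian_bumpFn hε]
  refine integral_eq_zero_of_ae (Filter.Eventually.of_forall fun x => ?_)
  rcases le_or_gt (ε / 3) ‖x‖ with h | h
  · simp [bumpFn_eq_zero hε h]
  · have h2 : ε / 3 ≤ ‖y - x‖ := by
      have := norm_sub_norm_le y x
      linarith
    simp [bumpFn_eq_zero hε h2]

end Profile

/-! ### Quantitative lower bounds for the profile and the kernel -/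

section LowerBounds

variable {d : ℕ} {ε R : ℝ}

local notation "𝔼" => EuclideanSpace ℝ (Fin d)

lemma integral_bumpFn_ge (hε : 0 < ε) : (2 * ε / (5 * d)) ^ d ≤ ∫ x : 𝔼, bumpFn ε x := by
  have h1 := volume_real_euclideanClosedBall_ge (d := d) (r := ε / 5) (by positivity)
  have h2 : ∫ x in Metric.closedBall (0 : 𝔼) (ε / 5), bumpFn ε x =
      (volume : Measure 𝔼).real (Metric.closedBall 0 (ε / 5)) := by
    rw [setIntegral_congr_fun (g := fun _ => 1) Metric.isClosed_closedBall.measurableSet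
      (fun x hx => bumpFn_eq_one hε (by simpa using hx))]
    simp
  have h3 := setIntegral_le_integral (s := Metric.closedBall (0 : 𝔼) (ε / 5))
    (integrable_bumpFn (E := 𝔼) hε) (Filter.Eventually.of_forall fun x => bumpFn_nonneg x)
  rw [h2] at h3
  refine le_trans (le_of_eq ?_) (h1.trans h3)
  congr 1
  field_simp

lemma integral_bumpFn_le_one (hε : 0 < ε) (hε1 : ε < 1) : ∫ x : 𝔼, bumpFn ε x ≤ 1 := by
  have h1 := volume_real_euclideanClosedBall_le (d := d) (r := ε / 3) (by positivity)
  have h2 : ∫ x : 𝔼, bumpFn ε x = ∫ x in Metric.closedBall (0 : 𝔼) (ε / 3), bumpFn ε x := by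
    refine (setIntegral_eq_integral_of_forall_compl_eq_zero fun x hx => ?_).symm
    exact bumpFn_eq_zero hε (by simpa using (not_le.1 (by simpa using hx)).le)
  have h3 : ∫ x in Metric.closedBall (0 : 𝔼) (ε / 3), bumpFn ε x ≤
      ∫ x in Metric.closedBall (0 : 𝔼) (ε / 3), (1 : ℝ) :=
    setIntegral_mono (integrable_bumpFn hε).integrableOn
      (integrableOn_const measure_closedBall_lt_top.ne) fun x => bumpFn_le_one x
  rw [h2]
  refine h3.trans ?_
  simp only [integral_const, MeasurableSet.univ, measureReal_restrict_apply, Set.univ_inter,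
    smul_eq_mul, mul_one]
  exact h1.trans (pow_le_one₀ (by positivity) (by linarith))

lemma gaussianReal_real_Icc_ge {r : ℝ} (hr : 1 ≤ r) :
    (√(2 * Real.pi))⁻¹ * Real.exp (-2 * r ^ 2) ≤ (gaussianReal 0 1).real (Set.Icc r (2 * r)) := by
  rw [measureReal_def, gaussianReal_apply_eq_integral _ (by simp),
    ENNReal.toReal_ofReal (integral_nonneg fun _ => gaussianPDFReal_nonneg _ _ _)]
  have h : ∫ x in Set.Icc r (2 * r), (√(2 * Real.pi))⁻¹ * Real.exp (-2 * r ^ 2) ≤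
      ∫ x in Set.Icc r (2 * r), gaussianPDFReal 0 1 x := by
    refine setIntegral_mono_on (integrableOn_const (by simp))
      (integrable_gaussianPDFReal 0 1).integrableOn measurableSet_Icc fun x hx => ?_
    simp only [gaussianPDFReal, NNReal.coe_one, mul_one, sub_zero]
    gcongr
    have : x ^ 2 ≤ (2 * r) ^ 2 := pow_le_pow_left₀ (by linarith [hx.1]) hx.2 2
    linarith
  refine le_trans ?_ h
  simp only [integral_const, MeasurableSet.univ, measureReal_restrict_apply, Set.univ_inter,
    Real.volume_real_Icc, smul_eq_mul]
  refine le_mul_of_one_le_left (by positivity) ?_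
  rw [max_eq_left] <;> linarith

/-- Where the bump is nonzero, ‖y • z‖ ≤ R + ε/3 ≤ 2R, hence ‖z‖ ≤ 2√R and the Gaussian density at z
is at least (2π)^(-d/2) exp(-2R). The substitution by y contributes the factor y^(-d). -/
lemma integral_stdGaussian_bumpFn_ge (hε : 0 < ε) (hε1 : ε < 1) (hR : 1 ≤ R) {x : 𝔼}
    (hx : ‖x‖ ≤ R) {y : ℝ} (hy : y ∈ Set.Icc (√R) (2 * √R)) :
    (2 * Real.pi) ^ (-(d / 2 : ℝ)) * Real.exp (-2 * R) *
      (((2 * √R) ^ d)⁻¹ * ∫ x : 𝔼, bumpFn ε x) ≤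
    ∫ z, bumpFn ε (x - y • z) ∂(stdGaussian 𝔼) := by
  have hR0 : 0 < √R := Real.sqrt_pos.2 (by linarith)
  have hy0 : 0 < y := hR0.trans_le hy.1
  rw [integral_stdGaussian]
  have h1 : ∫ z : 𝔼, bumpFn ε (x - y • z) = (y ^ d)⁻¹ * ∫ x : 𝔼, bumpFn ε x := by
    have h := Measure.integral_comp_smul_of_nonneg (volume : Measure 𝔼)
      (fun z => bumpFn ε (x - z)) y (hR := hy0.le)
    rw [h, finrank_euclideanSpace_fin, smul_eq_mul,
      integral_sub_left_eq_self (fun z : 𝔼 => bumpFn ε z) volume x]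
  have hint : Integrable (fun z : 𝔼 => bumpFn ε (x - y • z)) :=
    ((integrable_bumpFn (E := 𝔼) hε).comp_sub_left x).comp_smul hy0.ne'
  have hI : 0 ≤ ∫ x : 𝔼, bumpFn ε x := integral_nonneg fun _ => bumpFn_nonneg _
  calc _ ≤ (2 * Real.pi) ^ (-(d / 2 : ℝ)) * Real.exp (-2 * R) *
      ((y ^ d)⁻¹ * ∫ x : 𝔼, bumpFn ε x) := by
        gcongr
        exact hy.2
    _ = ∫ z : 𝔼, (2 * Real.pi) ^ (-(d / 2 : ℝ)) * Real.exp (-2 * R) * bumpFn ε (x - y • z) := by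
        rw [integral_const_mul, h1]
    _ ≤ _ := by
        refine integral_mono (hint.const_mul _) ?_ fun z => ?_
        · refine (integrable_gaussianDensity (E := 𝔼)).mono'
            (Continuous.aestronglyMeasurable ?_) (Filter.Eventually.of_forall fun z => ?_)
          · have := continuous_gaussianDensity (E := 𝔼)
            fun_prop
          · rw [norm_smul, Real.norm_eq_abs, abs_of_pos (gaussianDensity_pos z)]
            exact mul_le_of_le_one_right (gaussianDensity_pos z).le (norm_bumpFn_le_one _)
        · dsimp only
          rw [smul_eq_mul, gaussianDensity, finrank_euclideanSpace_fin]
          rcases le_or_gt (ε / 3) ‖x - y • z‖ with h | h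
          · simp [bumpFn_eq_zero hε h]
          · have hz : y * ‖z‖ ≤ 2 * R := by
              have h2 : ‖y • z‖ ≤ ‖x‖ + ‖x - y • z‖ := by
                have := norm_sub_le x (x - y • z)
                simpa using this
              rw [norm_smul, Real.norm_eq_abs, abs_of_pos hy0] at h2
              linarith
            have hz2 : ‖z‖ ≤ 2 * √R := by
              have h3 : √R * ‖z‖ ≤ 2 * R := (mul_le_mul_of_nonneg_right hy.1
                  (norm_nonneg z)).trans hz
              have h4 : √R * √R = R := Real.mul_self_sqrt (by linarith)
              have h5 : √R * ‖z‖ ≤ √R * (2 * √R) := by nlinarith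
              exact le_of_mul_le_mul_left h5 hR0
            have hz3 : ‖z‖ ^ 2 ≤ 4 * R := by
              calc ‖z‖ ^ 2 ≤ (2 * √R) ^ 2 := pow_le_pow_left₀ (norm_nonneg z) hz2 2
                _ = 4 * R := by rw [mul_pow, Real.sq_sqrt (by linarith)]; norm_num
            have := bumpFn_nonneg (ε := ε) (x - y • z)
            gcongr
            linarith

/-- To reach distance R, let `Y` be of order √R. Then `Y` and `Z` both pay a Gaussian cost
exponential in R rather than in R², which is what makes radii of order d log d affordable. -/
lemma besselProfile_ge (hd : 1 ≤ d) (hε : 0 < ε) (hε1 : ε < 1) (hR : 1 ≤ R) {x : 𝔼}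
    (hx : ‖x‖ ≤ R) :
    (1 / (13 * R)) ^ d * Real.exp (-4 * R) * (2 * ε / (5 * d)) ^ d ≤ besselProfile ε x := by
  set K : ℝ := (2 * Real.pi) ^ (-(d / 2 : ℝ)) * Real.exp (-2 * R) *
      (((2 * √R) ^ d)⁻¹ * ∫ x : 𝔼, bumpFn ε x) with hK
  have hI : 0 ≤ ∫ x : 𝔼, bumpFn ε x := integral_nonneg fun _ => bumpFn_nonneg _
  have hK0 : 0 ≤ K := by positivity
  have hsR : 1 ≤ √R := Real.one_le_sqrt.2 hR
  have hg : Continuous fun y : ℝ => ∫ z, bumpFn ε (x - y • z) ∂(stdGaussian 𝔼) := by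
    refine continuous_of_dominated (bound := fun _ => 1) (fun x => ?_)
      (fun x => Filter.Eventually.of_forall fun w => norm_bumpFn_le_one _) (integrable_const _)
      (Filter.Eventually.of_forall fun w => by fun_prop)
    exact Continuous.aestronglyMeasurable (by fun_prop)
  have h1 : K * (gaussianReal 0 1).real (Set.Icc (√R) (2 * √R)) ≤ besselProfile ε x := by
    rw [besselProfile_eq]
    have : K * (gaussianReal 0 1).real (Set.Icc (√R) (2 * √R)) =
        ∫ y, (Set.Icc (√R) (2 * √R)).indicator (fun _ => K) y ∂(gaussianReal 0 1) := by
      rw [integral_indicator measurableSet_Icc]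
      simp [mul_comm]
    rw [this]
    refine integral_mono ((integrable_const K).indicator measurableSet_Icc) ?_ fun y => ?_
    · refine (integrable_const (1 : ℝ)).mono' hg.aestronglyMeasurable
        (Filter.Eventually.of_forall fun y => ?_)
      refine (norm_integral_le_of_norm_le_const (C := 1)
        (Filter.Eventually.of_forall fun w => norm_bumpFn_le_one _)).trans ?_
      simp
    · by_cases hy : y ∈ Set.Icc (√R) (2 * √R)
      · simp only [hy, Set.indicator_of_mem]
        exact integral_stdGaussian_bumpFn_ge hε hε1 hR hx hy
      · simp only [hy, not_false_eq_true, Set.indicator_of_notMem]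
        exact integral_nonneg fun _ => bumpFn_nonneg _
  refine le_trans ?_ h1
  have h2 := gaussianReal_real_Icc_ge hsR
  rw [Real.sq_sqrt (by linarith)] at h2
  refine le_trans ?_ (mul_le_mul_of_nonneg_left h2 hK0)
  have hI2 := integral_bumpFn_ge (d := d) hε
  have hpi : (1 : ℝ) ≤ 2 * Real.pi := by linarith [Real.pi_gt_three]
  -- The exponents d/2 and 1/2 add up to at most d because d ≥ 1.
  have h3 : ((2 * Real.pi) ^ d)⁻¹ ≤ (2 * Real.pi) ^ (-(d / 2 : ℝ)) * (√(2 * Real.pi))⁻¹ := by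
    rw [Real.sqrt_eq_rpow, ← Real.rpow_neg (by positivity), ← Real.rpow_add (by positivity),
      ← Real.rpow_natCast, ← Real.rpow_neg (by positivity)]
    refine Real.rpow_le_rpow_of_exponent_le hpi ?_
    have : (1 : ℝ) ≤ d := by exact_mod_cast hd
    linarith
  -- The constant 13 is an upper bound for 4π.
  have h4 : (1 / (13 * R)) ^ d ≤ ((2 * Real.pi) ^ d)⁻¹ * ((2 * √R) ^ d)⁻¹ := by
    rw [← mul_inv, ← mul_pow, ← inv_pow]
    refine pow_le_pow_left₀ (by positivity) ?_ d
    rw [one_div]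
    refine inv_anti₀ (by positivity) ?_
    have h5 : √R ≤ R := by
      have := Real.mul_self_sqrt (show (0 : ℝ) ≤ R by linarith)
      nlinarith
    calc 2 * Real.pi * (2 * √R) = (4 * Real.pi) * √R := by ring
      _ ≤ 13 * R := by
        refine mul_le_mul ?_ h5 (by positivity) (by norm_num)
        linarith [Real.pi_lt_d2]
  calc _ ≤ (((2 * Real.pi) ^ d)⁻¹ * ((2 * √R) ^ d)⁻¹) * Real.exp (-4 * R) *
        ∫ x : 𝔼, bumpFn ε x := by gcongr
    _ ≤ (((2 * Real.pi) ^ (-(d / 2 : ℝ)) * (√(2 * Real.pi))⁻¹) * ((2 * √R) ^ d)⁻¹) *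
        Real.exp (-4 * R) * ∫ x : 𝔼, bumpFn ε x := by gcongr
    _ = _ := by
      rw [hK, show -4 * R = -2 * R + -2 * R by ring, Real.exp_add]
      ring

lemma integrable_besselProfile_mul (hε : 0 < ε) (y : 𝔼) :
    Integrable fun x : 𝔼 => besselProfile ε x * besselProfile ε (x - y) := by
  refine (integrable_besselProfile (E := 𝔼) hε).mono' (Continuous.aestronglyMeasurable
    (by fun_prop)) (Filter.Eventually.of_forall fun x => ?_)
  rw [norm_mul, Real.norm_eq_abs, abs_of_nonneg (besselProfile_nonneg x)]
  exact mul_le_of_le_one_right (besselProfile_nonneg x) (norm_besselProfile_le_one _)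

lemma besselKernel_nonneg (y : 𝔼) : 0 ≤ besselKernel ε y :=
  integral_nonneg fun _ => mul_nonneg (besselProfile_nonneg _) (besselProfile_nonneg _)

/-- Used to see that normalizing by the value at the origin can only increase the kernel, so its
lower bounds persist. -/
lemma besselKernel_le_one (hε : 0 < ε) (hε1 : ε < 1) (y : 𝔼) : besselKernel ε y ≤ 1 := by
  calc besselKernel ε y ≤ ∫ x : 𝔼, besselProfile ε x :=
        integral_mono (integrable_besselProfile_mul hε y) (integrable_besselProfile hε) fun x =>
          mul_le_of_le_one_right (besselProfile_nonneg x) (besselProfile_le_one _)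
    _ ≤ 1 := by rw [integral_besselProfile hε]; exact integral_bumpFn_le_one hε hε1

/-- A quantitative lower bound for the kernel on the ball of radius `R - 1`. -/
theorem besselKernel_ge (hd : 1 ≤ d) (hε : 0 < ε) (hε1 : ε < 1) (hR : 1 ≤ R) {y : 𝔼}
    (hy : ‖y‖ + 1 ≤ R) :
    (2 / d) ^ d * ((1 / (13 * R)) ^ d * Real.exp (-4 * R) * (2 * ε / (5 * d)) ^ d) ^ 2 ≤
      besselKernel ε y := by
  set K : ℝ := (1 / (13 * R)) ^ d * Real.exp (-4 * R) * (2 * ε / (5 * d)) ^ d with hK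
  have hK0 : 0 ≤ K := by positivity
  have h1 : ∫ x in Metric.closedBall (0 : 𝔼) 1, K ^ 2 ≤
      ∫ x in Metric.closedBall (0 : 𝔼) 1, besselProfile ε x * besselProfile ε (x - y) := by
    refine setIntegral_mono_on (integrableOn_const measure_closedBall_lt_top.ne)
      (integrable_besselProfile_mul hε y).integrableOn
      Metric.isClosed_closedBall.measurableSet fun x hx => ?_
    have hx1 : ‖x‖ ≤ 1 := by simpa using hx
    rw [sq]
    refine mul_le_mul (besselProfile_ge hd hε hε1 hR (hx1.trans hR))
      (besselProfile_ge hd hε hε1 hR ?_) hK0 (besselProfile_nonneg _)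
    have := norm_sub_le x y
    linarith
  have h2 : ∫ x in Metric.closedBall (0 : 𝔼) 1, besselProfile ε x * besselProfile ε (x - y) ≤
      besselKernel ε y := setIntegral_le_integral (integrable_besselProfile_mul hε y)
    (Filter.Eventually.of_forall fun x =>
      mul_nonneg (besselProfile_nonneg _) (besselProfile_nonneg _))
  refine le_trans ?_ (h1.trans h2)
  simp only [integral_const, MeasurableSet.univ, measureReal_restrict_apply, Set.univ_inter,
    smul_eq_mul]
  have h3 := volume_real_euclideanClosedBall_ge (d := d) (r := 1) zero_le_one
  rw [mul_one] at h3
  gcongr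

lemma besselKernel_zero_pos (hd : 1 ≤ d) (hε : 0 < ε) (hε1 : ε < 1) :
    0 < besselKernel ε (0 : 𝔼) := by
  refine lt_of_lt_of_le ?_ (besselKernel_ge hd hε hε1 le_rfl (y := 0) (by simp))
  have : (0 : ℝ) < d := by exact_mod_cast hd
  positivity

end LowerBounds

/-! ### The activation and its potential -/

section Activation

variable {d : ℕ} {ε : ℝ}

local notation "𝔼" => EuclideanSpace ℝ (Fin d)

/-- The kernel normalized to have value `1` at the origin. -/
def normalizedKernel (d : ℕ) (ε : ℝ) (y : EuclideanSpace ℝ (Fin d)) : ℝ :=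
  (besselKernel ε (0 : EuclideanSpace ℝ (Fin d)))⁻¹ * besselKernel ε y

/-- The activation whose potential is `normalizedKernel`. -/
def harmonicActivation (d : ℕ) (ε : ℝ) (x w : EuclideanSpace ℝ (Fin d)) : ℝ :=
  Real.exp (‖x‖ ^ 2 / 4) * (√((2 * Real.pi) ^ (d / 2 : ℝ) *
    (besselKernel ε (0 : EuclideanSpace ℝ (Fin d)))⁻¹) * besselProfile ε (x - w))

/-- The two factors exp(‖x‖²/4) cancel the Gaussian exponential exactly, so the Gaussian inner
product of two activations becomes a Lebesgue inner product of translated profiles. -/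
lemma gaussianDensity_mul_harmonicActivation_mul (x θ w : 𝔼) :
    gaussianDensity x * (harmonicActivation d ε x θ * harmonicActivation d ε x w) =
      (besselKernel ε (0 : 𝔼))⁻¹ * (besselProfile ε (x - θ) * besselProfile ε (x - w)) := by
  have h1 : Real.exp (-‖x‖ ^ 2 / 2) * (Real.exp (‖x‖ ^ 2 / 4) * Real.exp (‖x‖ ^ 2 / 4)) = 1 := by
    rw [← Real.exp_add, ← Real.exp_add, ← Real.exp_zero]
    congr 1
    ring
  have h2 : (2 * Real.pi) ^ (-(d / 2 : ℝ)) * (2 * Real.pi) ^ (d / 2 : ℝ) = 1 := by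
    rw [← Real.rpow_add (by positivity), neg_add_cancel, Real.rpow_zero]
  have h3 := Real.mul_self_sqrt (show 0 ≤ (2 * Real.pi) ^ (d / 2 : ℝ) *
    (besselKernel ε (0 : 𝔼))⁻¹ from mul_nonneg (by positivity)
      (inv_nonneg.2 (besselKernel_nonneg _)))
  rw [gaussianDensity, finrank_euclideanSpace_fin, harmonicActivation, harmonicActivation]
  set s := √((2 * Real.pi) ^ (d / 2 : ℝ) * (besselKernel ε (0 : 𝔼))⁻¹)
  set p := besselProfile ε (x - θ)
  set r := besselProfile ε (x - w)
  calc _ = (2 * Real.pi) ^ (-(d / 2 : ℝ)) * (Real.exp (-‖x‖ ^ 2 / 2) *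
        (Real.exp (‖x‖ ^ 2 / 4) * Real.exp (‖x‖ ^ 2 / 4))) * (s * s) * (p * r) := by ring
    _ = ((2 * Real.pi) ^ (-(d / 2 : ℝ)) * (2 * Real.pi) ^ (d / 2 : ℝ)) *
        ((besselKernel ε (0 : 𝔼))⁻¹ * (p * r)) := by rw [h1, h3]; ring
    _ = _ := by rw [h2, one_mul]

theorem potential_harmonicActivation (θ w : 𝔼) :
    potential (harmonicActivation d ε) θ w = normalizedKernel d ε (θ - w) := by
  rw [potential, integral_stdGaussian]
  simp_rw [smul_eq_mul, gaussianDensity_mul_harmonicActivation_mul]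
  rw [integral_const_mul, normalizedKernel, besselKernel_congr (norm_sub_rev θ w)]
  congr 1
  rw [besselKernel, ← integral_add_right_eq_self (fun x => _ * _) θ]
  refine integral_congr_ae (Filter.Eventually.of_forall fun x => ?_)
  dsimp only
  rw [add_sub_cancel_right, sub_sub_eq_add_sub]

theorem memLp_harmonicActivation (hε : 0 < ε) (w : 𝔼) :
    MemLp (fun x => harmonicActivation d ε x w) 2 (stdGaussian 𝔼) := by
  have hc : Continuous fun x => harmonicActivation d ε x w := by
    unfold harmonicActivation; fun_prop
  rw [memLp_two_iff_integrable_sq hc.aestronglyMeasurable, stdGaussian_eq_withDensity,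
    integrable_withDensity_iff_integrable_smul' continuous_gaussianDensity.measurable.ennreal_ofReal
      (by simp)]
  simp_rw [ENNReal.toReal_ofReal (gaussianDensity_pos _).le, smul_eq_mul, sq,
    gaussianDensity_mul_harmonicActivation_mul]
  refine Integrable.const_mul ?_ _
  simpa using (integrable_besselProfile_mul hε (0 : 𝔼)).comp_sub_right w

lemma normalizedKernel_congr {x y : 𝔼} (h : ‖x‖ = ‖y‖) :
    normalizedKernel d ε x = normalizedKernel d ε y := by
  rw [normalizedKernel, besselKernel_congr h, normalizedKernel]

lemma normalizedKernel_zero (hd : 1 ≤ d) (hε : 0 < ε) (hε1 : ε < 1) :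
    normalizedKernel d ε 0 = 1 := inv_mul_cancel₀ (besselKernel_zero_pos hd hε hε1).ne'

theorem contDiff_normalizedKernel (hε : 0 < ε) (hε1 : ε < 1) :
    ContDiff ℝ 3 (normalizedKernel d ε) := by
  obtain ⟨A, -, hA⟩ := exists_bumpFn_bound
  exact contDiff_const.mul (contDiff_besselKernel (n := 3) hε (hA d ε hε hε1))

theorem laplacian_normalizedKernel (hε : 0 < ε) (hε1 : ε < 1) {y : 𝔼} (hy : ε ≤ ‖y‖) :
    Laplacian.laplacian (normalizedKernel d ε) y = normalizedKernel d ε y := by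
  obtain ⟨A, -, hA⟩ := exists_bumpFn_bound
  have hA2 := fun j (hj : j ≤ 2) => hA d ε hε hε1 j (by omega)
  have h1 : normalizedKernel d ε = (besselKernel ε (0 : 𝔼))⁻¹ • (besselKernel ε : 𝔼 → ℝ) := rfl
  rw [h1, InnerProductSpace.laplacian_smul _ (contDiff_besselKernel (n := 2) hε hA2).contDiffAt,
    laplacian_besselKernel hε hy hA2]
  rfl

lemma laplacian_comp_sub_const {E : Type*} [NormedAddCommGroup E] [InnerProductSpace ℝ E]
    [FiniteDimensional ℝ E] (f : E → ℝ) (w x : E) :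
    Laplacian.laplacian (fun u => f (u - w)) x = Laplacian.laplacian f (x - w) := by
  simp only [InnerProductSpace.laplacian_eq_iteratedFDeriv_stdOrthonormalBasis]
  simp only [iteratedFDeriv_comp_sub]

theorem isAlmostHarmonicActivation_harmonicActivation (hd : 1 ≤ d) (hε : 0 < ε) (hε1 : ε < 1) :
    IsAlmostHarmonicActivation ε (harmonicActivation d ε) := by
  -- A radial function is recovered from its values along the ray through a fixed unit vector.
  obtain ⟨e, he⟩ : ∃ e : 𝔼, ‖e‖ = 1 := ⟨EuclideanSpace.single ⟨0, hd⟩ 1, by simp⟩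
  have hne : ∀ r : ℝ, 0 ≤ r → ‖r • e‖ = r := fun r hr => by
    rw [norm_smul, he, mul_one, Real.norm_of_nonneg hr]
  refine ⟨⟨fun r => √((2 * Real.pi) ^ (d / 2 : ℝ) * (besselKernel ε (0 : 𝔼))⁻¹) *
    besselProfile ε (r • e), fun x w => ?_⟩, memLp_harmonicActivation hε,
    ⟨fun r => normalizedKernel d ε (r • e), fun θ w => ?_⟩, fun θ => ?_, fun θ w h => ?_⟩
  · rw [harmonicActivation, besselProfile_congr (hne _ (norm_nonneg (x - w))).symm]
  · exact (potential_harmonicActivation θ w).trans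
      (normalizedKernel_congr (hne _ (norm_nonneg (θ - w))).symm)
  · rw [potential_harmonicActivation, sub_self, normalizedKernel_zero hd hε hε1]
  · simp_rw [potential_harmonicActivation]
    refine ⟨?_, ?_⟩
    · exact (((contDiff_normalizedKernel hε hε1).of_le (by norm_num)).comp
        (contDiff_id.sub contDiff_const)).contDiffAt
    · rw [laplacian_comp_sub_const, laplacian_normalizedKernel hε hε1 h]

/-- The derivatives of the normalized kernel, up to order three, in terms of the value of the
unnormalized one at the origin. -/
theorem exists_normalizedKernel_bound : ∃ A : ℝ, 1 ≤ A ∧ ∀ (d : ℕ) (ε : ℝ), 0 < ε → ε < 1 →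
    ∀ j ≤ 3, ∀ x : EuclideanSpace ℝ (Fin d), ‖iteratedFDeriv ℝ j (normalizedKernel d ε) x‖ ≤
      (besselKernel ε (0 : EuclideanSpace ℝ (Fin d)))⁻¹ * (A / ε ^ 3) := by
  obtain ⟨A, hA1, hA⟩ := exists_bumpFn_bound
  refine ⟨A, hA1, fun d ε hε hε1 j hj x => ?_⟩
  have h1 : normalizedKernel d ε = (besselKernel ε (0 : EuclideanSpace ℝ (Fin d)))⁻¹ •
    (besselKernel ε : EuclideanSpace ℝ (Fin d) → ℝ) := rfl
  have h2 := norm_iteratedFDeriv_besselKernel_le hε (hA d ε hε hε1) hj x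
  have h3 := integral_bumpFn_le_one (d := d) hε hε1
  have h4 := inv_nonneg.2 (besselKernel_nonneg (ε := ε) (0 : EuclideanSpace ℝ (Fin d)))
  rw [h1, iteratedFDeriv_const_smul_apply (((contDiff_besselKernel (n := 3) hε
    (hA d ε hε hε1)).of_le (by exact_mod_cast hj)).contDiffAt), norm_smul, Real.norm_of_nonneg h4]
  refine mul_le_mul_of_nonneg_left (h2.trans ?_) h4
  exact mul_le_of_le_one_right (by positivity) h3

end Activation

/-! ### Taylor's formula along segments -/

section Taylor

variable {M : Type*} [NormedAddCommGroup M] [NormedSpace ℝ M] {f : M → ℝ}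

lemma iteratedDeriv_comp_add_smul {n : ℕ} (hf : ContDiff ℝ n f) (x p : M) (s : ℝ) :
    iteratedDeriv n (fun s : ℝ => f (x + s • p)) s =
      iteratedFDeriv ℝ n f (x + s • p) fun _ => p := by
  set L : ℝ →L[ℝ] M := ContinuousLinearMap.toSpanSingleton ℝ p with hL
  have h1 : (fun s : ℝ => f (x + s • p)) = (fun z => f (x + z)) ∘ L := rfl
  rw [iteratedDeriv_eq_iteratedFDeriv, h1, L.iteratedFDeriv_comp_right
    (show ContDiff ℝ n fun z => f (x + z) from hf.comp (contDiff_const.add contDiff_id)) s le_rfl]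
  rw [ContinuousMultilinearMap.compContinuousLinearMap_apply, iteratedFDeriv_comp_add_left]
  simp [hL]

lemma taylorWithinEval_eq_sum {g : ℝ → ℝ} {n : ℕ} (hg : ContDiff ℝ n g) :
    taylorWithinEval g n (Set.uIcc 0 1) 0 1 =
      ∑ j ∈ Finset.range (n + 1), ((j.factorial : ℝ))⁻¹ * iteratedDeriv j g 0 := by
  rw [taylor_within_apply]
  refine Finset.sum_congr rfl fun j hj => ?_
  rw [iteratedDerivWithin_eq_iteratedDeriv (uniqueDiffOn_uIcc zero_ne_one)
    ((hg.of_le (by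
      have := Finset.mem_range.1 hj
      exact_mod_cast (by omega : j ≤ n))).contDiffAt) (Set.left_mem_uIcc)]
  simp

/-- Taylor's formula of order one along a segment. -/
theorem exists_taylor_one (hf : ContDiff ℝ 2 f) (x p : M) : ∃ s ∈ Set.Ioo (0 : ℝ) 1,
    f (x + p) = f x + fderiv ℝ f x p + iteratedFDeriv ℝ 2 f (x + s • p) (fun _ => p) / 2 := by
  set g : ℝ → ℝ := fun s => f (x + s • p)
  have hg : ContDiff ℝ 2 g := hf.comp (by fun_prop)
  obtain ⟨s, hs, h⟩ := taylor_mean_remainder_lagrange_iteratedDeriv (f := g) (x := 1) (x₀ := 0)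
    (n := 1) zero_ne_one (by exact_mod_cast hg.contDiffOn)
  rw [taylorWithinEval_eq_sum (hg.of_le (by norm_num)), iteratedDeriv_comp_add_smul hf] at h
  rw [Set.uIoo_of_le zero_le_one] at hs
  refine ⟨s, hs, ?_⟩
  have h1 : iteratedDeriv 1 g 0 = fderiv ℝ f x p := by
    rw [iteratedDeriv_comp_add_smul (hf.of_le (by norm_num)), iteratedFDeriv_one_apply]
    simp
  simp [Finset.sum_range_succ, h1, g, -iteratedDeriv_one, Nat.factorial] at h
  linarith

/-- Taylor's formula of order two along a segment. -/
theorem exists_taylor_two (hf : ContDiff ℝ 3 f) (x p : M) : ∃ s ∈ Set.Ioo (0 : ℝ) 1,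
    f (x + p) = f x + fderiv ℝ f x p + iteratedFDeriv ℝ 2 f x (fun _ => p) / 2 +
      iteratedFDeriv ℝ 3 f (x + s • p) (fun _ => p) / 6 := by
  set g : ℝ → ℝ := fun s => f (x + s • p)
  have hg : ContDiff ℝ 3 g := hf.comp (by fun_prop)
  obtain ⟨s, hs, h⟩ := taylor_mean_remainder_lagrange_iteratedDeriv (f := g) (x := 1) (x₀ := 0)
    (n := 2) zero_ne_one (by
      have : ((2 : ℕ) : WithTop ℕ∞) + 1 = 3 := by norm_num
      rw [this]; exact hg.contDiffOn)
  rw [taylorWithinEval_eq_sum (hg.of_le (by norm_num)), iteratedDeriv_comp_add_smul hf] at h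
  rw [Set.uIoo_of_le zero_le_one] at hs
  refine ⟨s, hs, ?_⟩
  have h1 : iteratedDeriv 1 g 0 = fderiv ℝ f x p := by
    rw [iteratedDeriv_comp_add_smul (hf.of_le (by norm_num)), iteratedFDeriv_one_apply]
    simp
  have h2 : iteratedDeriv 2 g 0 = iteratedFDeriv ℝ 2 f x (fun _ => p) := by
    rw [iteratedDeriv_comp_add_smul (hf.of_le (by norm_num))]
    simp
  simp [Finset.sum_range_succ, h1, h2, g, -iteratedDeriv_one, Nat.factorial] at h
  linarith

lemma abs_iteratedFDeriv_const_le {n : ℕ} {x p : M} {K : ℝ} (h : ‖iteratedFDeriv ℝ n f x‖ ≤ K) :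
    |iteratedFDeriv ℝ n f x (fun _ => p)| ≤ K * ‖p‖ ^ n := by
  have h1 := (iteratedFDeriv ℝ n f x).le_opNorm fun _ => p
  rw [Finset.prod_const, Finset.card_univ, Fintype.card_fin] at h1
  exact h1.trans (mul_le_mul_of_nonneg_right h (by positivity))

end Taylor

/-! ### The Hessian and its smallest eigenvalue -/

section Hessian

variable {M : Type*} [NormedAddCommGroup M] [InnerProductSpace ℝ M] [CompleteSpace M] {f : M → ℝ}
  {x : M}

lemma norm_gradient_eq (f : M → ℝ) (x : M) : ‖gradient f x‖ = ‖iteratedFDeriv ℝ 1 f x‖ := by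
  rw [norm_iteratedFDeriv_one, gradient, LinearIsometryEquiv.norm_map]

variable (M) in
/-- The inverse of the Riesz isomorphism of a real Hilbert space, as a linear map. -/
def rieszInverse : StrongDual ℝ M →L[ℝ] M :=
  LinearMap.mkContinuous
    { toFun := (InnerProductSpace.toDual ℝ M).symm
      map_add' := map_add _
      map_smul' := fun c y => by simp } 1 (fun y => by simp)

lemma inner_hessian (hf : ContDiffAt ℝ 2 f x) (v w : M) :
    inner ℝ (hessian f x v) w = iteratedFDeriv ℝ 2 f x ![v, w] := by
  have h1 : DifferentiableAt ℝ (fderiv ℝ f) x :=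
    (hf.fderiv_right (m := 1) (by norm_num)).differentiableAt (by norm_num)
  have h2 : HasFDerivAt (gradient f) ((rieszInverse M).comp (fderiv ℝ (fderiv ℝ f) x)) x :=
    (rieszInverse M).hasFDerivAt.comp x h1.hasFDerivAt
  rw [iteratedFDeriv_two_apply, hessian, h2.fderiv]
  exact InnerProductSpace.toDual_symm_apply

lemma isSymmetric_hessian (hf : ContDiffAt ℝ 2 f x) :
    ((hessian f x : M →L[ℝ] M) : M →ₗ[ℝ] M).IsSymmetric := by
  intro v w
  have h := hf.isSymmSndFDerivAt (by simp)
  simp only [ContinuousLinearMap.coe_coe]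
  rw [real_inner_comm _ v, inner_hessian hf, inner_hessian hf, iteratedFDeriv_two_apply,
    iteratedFDeriv_two_apply]
  exact h.eq v w

/-- The smallest eigenvalue is at most any Rayleigh quotient. -/
lemma lambdaMin_mul_norm_sq_le [FiniteDimensional ℝ M] {H : M →L[ℝ] M}
    (hH : (H : M →ₗ[ℝ] M).IsSymmetric) (v : M) : lambdaMin H * ‖v‖ ^ 2 ≤ inner ℝ (H v) v := by
  rcases eq_or_ne v 0 with rfl | hv
  · simp
  have : Nontrivial M := ⟨v, 0, hv⟩
  -- In finite dimension the infimum of the Rayleigh quotient is an eigenvalue, so `lambdaMin` is at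
  -- most this infimum.
  have h1 := hH.hasEigenvalue_iInf_of_finiteDimensional
  have h2 : lambdaMin H ≤ _ :=
    csInf_le (Module.End.finite_hasEigenvalue (H : M →ₗ[ℝ] M)).bddBelow h1
  have h3 : BddBelow (Set.range fun x : {x : M // x ≠ 0} =>
      RCLike.re (inner ℝ ((H : M →ₗ[ℝ] M) x) (x : M)) / ‖(x : M)‖ ^ 2) := by
    refine ⟨-‖H‖, ?_⟩
    rintro _ ⟨y, rfl⟩
    have hy : 0 < ‖(y : M)‖ := norm_pos_iff.2 y.2
    rw [le_div_iff₀ (by positivity)]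
    have h4 := abs_real_inner_le_norm (H (y : M)) (y : M)
    have h5 := H.le_opNorm (y : M)
    have h6 := neg_abs_le (inner ℝ (H (y : M)) (y : M))
    simp only [ContinuousLinearMap.coe_coe, RCLike.re_to_real]
    nlinarith [norm_nonneg (y : M)]
  have h4 := h2.trans (ciInf_le h3 ⟨v, hv⟩)
  have hv0 : 0 < ‖v‖ := norm_pos_iff.2 hv
  have h5 := (le_div_iff₀ (by positivity)).1 h4
  simpa using h5

end Hessian

/-! ### Termination of SecondGD -/

section SecondGD

variable {M : Type*} [NormedAddCommGroup M] [InnerProductSpace ℝ M] [CompleteSpace M] {f : M → ℝ}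
  {x : M} {K α η γ : ℝ}

/-- The step has length at most αK = 1/2, so the segment stays where the second derivative is
bounded by K. The quadratic error is at most α‖∇f‖²/4, leaving a decrease of at least 3α‖∇f‖²/4. -/
lemma gradientStep_descent (hf : ContDiff ℝ 2 f) (hK : 1 ≤ K) (hα : α = 1 / (2 * K)) (hη : 0 < η)
    (hb : ∀ p : M, ‖p‖ ≤ 1 → ‖iteratedFDeriv ℝ 2 f (x + p)‖ ≤ K)
    (hb1 : ‖gradient f x‖ ≤ K) (hx : η ≤ ‖gradient f x‖) :
    f (x - α • gradient f x) < f x - α * η ^ 2 / 2 := by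
  have hα0 : 0 < α := by rw [hα]; positivity
  have hαK : α * K = 1 / 2 := by rw [hα]; field_simp
  set u := gradient f x with hu
  obtain ⟨s, hs, h⟩ := exists_taylor_one hf x (-(α • u))
  have hp : ‖-(α • u)‖ = α * ‖u‖ := by rw [norm_neg, norm_smul, Real.norm_of_nonneg hα0.le]
  have h1 : ‖s • -(α • u)‖ ≤ 1 := by
    rw [norm_smul, hp, Real.norm_of_nonneg hs.1.le]
    have : α * ‖u‖ ≤ 1 / 2 := by rw [← hαK]; gcongr
    nlinarith [hs.1, hs.2, norm_nonneg u, mul_nonneg hα0.le (norm_nonneg u)]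
  have h2 := le_of_abs_le (abs_iteratedFDeriv_const_le (p := -(α • u)) (hb _ h1))
  have h3 : fderiv ℝ f x (-(α • u)) = -(α * ‖u‖ ^ 2) := by
    rw [← inner_gradient_left, ← hu, inner_neg_right, inner_smul_right, real_inner_self_eq_norm_sq]
  rw [hp] at h2
  rw [sub_eq_add_neg, h, h3]
  have h4 : K * (α * ‖u‖) ^ 2 = α * ‖u‖ ^ 2 / 2 := by
    calc K * (α * ‖u‖) ^ 2 = (α * K) * (α * ‖u‖ ^ 2) := by ring
      _ = _ := by rw [hαK]; ring
  have h5 : α * η ^ 2 ≤ α * ‖u‖ ^ 2 := by gcongr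
  have h6 : 0 < α * η ^ 2 := by positivity
  linarith

/-- With step length α|λ| ≤ 1/2, the sign makes the linear term nonpositive, the quadratic term is
-α²|λ|³/2 and the cubic error at most α²|λ|³/12. Since |λ| ≥ 2γ, the decrease exceeds α²γ³/2. -/
lemma hessianStep_descent (hf : ContDiff ℝ 3 f) (hK : 1 ≤ K) (hα : α = 1 / (2 * K)) (hγ : 0 < γ)
    (hb : ∀ p : M, ‖p‖ ≤ 1 → ∀ j, 2 ≤ j → j ≤ 3 → ‖iteratedFDeriv ℝ j f (x + p)‖ ≤ K)
    {v : M → M} (hv : IsMinEigenvectorRule f v) (hx : lambdaMin (hessian f x) ≤ -2 * γ) :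
    f (hessianStep f v α x) < f x - α ^ 2 * γ ^ 3 / 2 := by
  have hf2 : ContDiff ℝ 2 f := hf.of_le (by norm_num)
  have hα0 : 0 < α := by rw [hα]; positivity
  have hαK : α * K = 1 / 2 := by rw [hα]; field_simp
  obtain ⟨hv1, hv2⟩ := hv x hf2.contDiffAt
  set lam := lambdaMin (hessian f x) with hlam
  set u := v x
  have hl : iteratedFDeriv ℝ 2 f x ![u, u] = lam := by
    rw [← inner_hessian hf2.contDiffAt, hv2, inner_smul_left, real_inner_self_eq_norm_sq, hv1]
    simp
  have hconst : (fun _ : Fin 2 => u) = ![u, u] := by ext i; fin_cases i <;> rfl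
  have hlK : |lam| ≤ K := by
    have := abs_iteratedFDeriv_const_le (p := u) (hb 0 (by simp) 2 le_rfl (by norm_num))
    rw [hv1, add_zero, hconst, hl] at this
    simpa using this
  have hlneg : |lam| = -lam := abs_of_neg (by linarith)
  set c := -(α * |lam| * sgn (inner ℝ (gradient f x) u)) with hc
  have hsgn : sgn (inner ℝ (gradient f x) u) ^ 2 = 1 := by unfold sgn; split_ifs <;> norm_num
  have hsgn2 : 0 ≤ sgn (inner ℝ (gradient f x) u) * inner ℝ (gradient f x) u := by
    unfold sgn; split_ifs with h <;> linarith
  have hc2 : c ^ 2 = (α * |lam|) ^ 2 := by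
    rw [hc, neg_sq, mul_pow (α * |lam|) (sgn _), hsgn, mul_one]
  have hcabs : |c| = α * |lam| := by
    rw [← sq_eq_sq₀ (abs_nonneg _) (by positivity), sq_abs, hc2]
  obtain ⟨s, hs, h⟩ := exists_taylor_two hf x (c • u)
  have hcu : ‖c • u‖ = α * |lam| := by rw [norm_smul, hv1, mul_one, Real.norm_eq_abs, hcabs]
  have h1 : ‖s • c • u‖ ≤ 1 := by
    rw [norm_smul, hcu, Real.norm_of_nonneg hs.1.le]
    have : α * |lam| ≤ 1 / 2 := by rw [← hαK]; gcongr
    nlinarith [hs.1, hs.2, mul_nonneg hα0.le (abs_nonneg lam)]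
  have h2 := le_of_abs_le (abs_iteratedFDeriv_const_le (p := c • u)
      (hb _ h1 3 (by norm_num) le_rfl))
  rw [hcu] at h2
  have h3 : fderiv ℝ f x (c • u) ≤ 0 := by
    rw [← inner_gradient_left, inner_smul_right, hc]
    have := mul_nonneg (mul_nonneg hα0.le (abs_nonneg lam)) hsgn2
    linarith
  have h4 : iteratedFDeriv ℝ 2 f x (fun _ => c • u) = (α * |lam|) ^ 2 * lam := by
    have := (iteratedFDeriv ℝ 2 f x).map_smul_univ (fun _ => c) (fun _ => u)
    rw [this, hconst, hl, Finset.prod_const, Finset.card_univ, Fintype.card_fin, hc2, smul_eq_mul]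
  have h5 : K * (α * |lam|) ^ 3 = α ^ 2 * |lam| ^ 3 / 2 := by
    calc K * (α * |lam|) ^ 3 = (α * K) * (α ^ 2 * |lam| ^ 3) := by ring
      _ = _ := by rw [hαK]; ring
  have h6 : (α * |lam|) ^ 2 * lam = -(α ^ 2 * |lam| ^ 3) := by
    have : lam = -|lam| := by rw [hlneg, neg_neg]
    calc (α * |lam|) ^ 2 * lam = (α * |lam|) ^ 2 * -|lam| := by rw [← this]
      _ = _ := by ring
  have h7 : α ^ 2 * (2 * γ) ^ 3 ≤ α ^ 2 * |lam| ^ 3 := by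
    gcongr
    linarith
  have h8 : 0 < α ^ 2 * γ ^ 3 := by positivity
  unfold hessianStep
  change f (x + c • u) < _
  rw [h, h4, h6]
  rw [h5] at h2
  have h9 : α ^ 2 * (2 * γ) ^ 3 = 8 * (α ^ 2 * γ ^ 3) := by ring
  linarith

/-- SecondGD on a nonnegative `C³` function whose derivatives are bounded near a sublevel set
terminates at a point of any set containing all approximate second order critical points. -/
theorem exists_secondGDReturns (hf : ContDiff ℝ 3 f) (h0 : ∀ x, 0 ≤ f x) {x₀ : M} (hK : 1 ≤ K)
    (hα : α = 1 / (2 * K)) (hη : 0 < η) (hγ : 0 < γ)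
    (hb : ∀ x, f x ≤ f x₀ → ∀ p : M, ‖p‖ ≤ 1 → ∀ j, 1 ≤ j → j ≤ 3 →
      ‖iteratedFDeriv ℝ j f (x + p)‖ ≤ K)
    {good : M → Prop} (hgood : ∀ x, f x ≤ f x₀ → ¬ good x → ‖gradient f x‖ < η →
      lambdaMin (hessian f x) ≤ -2 * γ)
    {v : M → M} (hv : IsMinEigenvectorRule f v) :
    ∃ (N : ℕ) (out : M), (N : ℝ) ≤ f x₀ / min (α * η ^ 2 / 2) (α ^ 2 * γ ^ 3 / 2) + 1 ∧
      SecondGDReturns f v α η γ x₀ N out ∧ good out := by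
  have hα0 : 0 < α := by rw [hα]; positivity
  set δ := min (α * η ^ 2 / 2) (α ^ 2 * γ ^ 3 / 2) with hδ
  have hδ0 : 0 < δ := lt_min (by positivity) (by positivity)
  have hstep : ∀ x, f x ≤ f x₀ → ¬ good x → ¬ SecondGDStops f v α η γ x := by
    intro x hx hg
    rw [SecondGDStops, not_le, ← hδ]
    unfold secondGDStep
    split_ifs with h
    · refine (gradientStep_descent (hf.of_le (by norm_num)) hK hα hη
        (fun p hp => hb x hx p hp 2 (by norm_num) (by norm_num)) ?_ h).trans_le
        (sub_le_sub_left (min_le_left _ _) _)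
      rw [norm_gradient_eq]
      simpa using hb x hx 0 (by simp) 1 le_rfl (by norm_num)
    · exact (hessianStep_descent hf hK hα hγ
        (fun p hp j hj hj3 => hb x hx p hp j (by omega) hj3) hv
        (hgood x hx hg (not_le.1 h))).trans_le (sub_le_sub_left (min_le_right _ _) _)
  set X : ℕ → M := secondGDIterate f v α η x₀ with hX
  have hXs : ∀ m, X (m + 1) = secondGDStep f v α η (X m) := fun m =>
    Function.iterate_succ_apply' _ _ _
  -- Until the test succeeds, every iteration lowers f by more than δ, so the run stays in the
  -- sublevel set of the start; as f ≥ 0, it must stop.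
  have hdec : ∀ m, (∀ i < m, ¬ SecondGDStops f v α η γ (X i)) → f (X m) ≤ f x₀ - m * δ := by
    intro m
    induction m with
    | zero => intro _; simp [hX, secondGDIterate]
    | succ m ih =>
      intro h
      have h1 := ih fun i hi => h i (by omega)
      have h2 := h m (by omega)
      rw [SecondGDStops, not_le, ← hXs, ← hδ] at h2
      push_cast
      linarith
  have hex : ∃ m, SecondGDStops f v α η γ (X m) := by
    by_contra! hne
    obtain ⟨m, hm⟩ := exists_nat_gt (f x₀ / δ)
    have h1 := hdec m fun i _ => hne i
    rw [div_lt_iff₀ hδ0] at hm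
    linarith [h0 (X m)]
  classical
  set m := Nat.find hex
  have hm : ∀ i < m, ¬ SecondGDStops f v α η γ (X i) := fun i hi => Nat.find_min hex hi
  have hfm := hdec m hm
  have hle : f (X m) ≤ f x₀ := hfm.trans (sub_le_self _ (by positivity))
  -- If `X m` is the first iterate passing the test, the stopping iteration has number m + 1.
  refine ⟨m + 1, X m, ?_, ⟨by omega, fun i _ => (hf.of_le (by norm_num)).contDiffAt,
    fun i hi => hm i (by omega), by simpa using Nat.find_spec hex, rfl⟩, ?_⟩
  · push_cast
    gcongr
    rw [le_div_iff₀ hδ0]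
    linarith [h0 (X m)]
  · by_contra hg
    exact hstep _ hle hg (Nat.find_spec hex)

end SecondGD

/-! ### Calculus of bounds for derivatives up to order three -/

section DerivBounds

variable {M : Type*} [NormedAddCommGroup M] [NormedSpace ℝ M]

/-- `f` is `C³` and its derivatives of order at most three are bounded by `B` at `x`. -/
def DerivBoundAt (f : M → ℝ) (x : M) (B : ℝ) : Prop :=
  ContDiff ℝ 3 f ∧ ∀ j ≤ 3, ‖iteratedFDeriv ℝ j f x‖ ≤ B

variable {f g : M → ℝ} {x : M} {B C : ℝ}

lemma DerivBoundAt.nonneg (h : DerivBoundAt f x B) : 0 ≤ B :=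
  (norm_nonneg _).trans (h.2 0 (by norm_num))

lemma DerivBoundAt.mono (h : DerivBoundAt f x B) (hBC : B ≤ C) : DerivBoundAt f x C :=
  ⟨h.1, fun j hj => (h.2 j hj).trans hBC⟩

lemma DerivBoundAt.add (hf : DerivBoundAt f x B) (hg : DerivBoundAt g x C) :
    DerivBoundAt (fun y => f y + g y) x (B + C) := by
  refine ⟨hf.1.add hg.1, fun j hj => ?_⟩
  have h := iteratedFDeriv_add_apply (𝕜 := ℝ) (i := j) (x := x)
    (hf.1.of_le (by exact_mod_cast hj)).contDiffAt (hg.1.of_le (by exact_mod_cast hj)).contDiffAt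
  have h2 : (fun y => f y + g y) = f + g := rfl
  rw [h2, h]
  exact (norm_add_le _ _).trans (add_le_add (hf.2 j hj) (hg.2 j hj))

/-- By Leibniz's rule; the constant 8 = 2³ is the largest sum of binomial coefficients up to order
three. -/
lemma DerivBoundAt.mul (hf : DerivBoundAt f x B) (hg : DerivBoundAt g x C) :
    DerivBoundAt (fun y => f y * g y) x (8 * (B * C)) := by
  have hB := hf.nonneg
  have hC := hg.nonneg
  refine ⟨hf.1.mul hg.1, fun j hj => ?_⟩
  refine (norm_iteratedFDeriv_mul_le hf.1 hg.1 x (by exact_mod_cast hj)).trans ?_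
  calc ∑ i ∈ Finset.range (j + 1), (j.choose i : ℝ) * ‖iteratedFDeriv ℝ i f x‖ *
        ‖iteratedFDeriv ℝ (j - i) g x‖
      ≤ ∑ i ∈ Finset.range (j + 1), (j.choose i : ℝ) * B * C := by
        refine Finset.sum_le_sum fun i hi => ?_
        have hi' := Finset.mem_range.1 hi
        gcongr
        · exact hf.2 i (by omega)
        · exact hg.2 (j - i) (by omega)
    _ = 2 ^ j * (B * C) := by
        simp_rw [mul_assoc]
        rw [← Finset.sum_mul]
        congr 1
        exact_mod_cast Nat.sum_range_choose j
    _ ≤ 8 * (B * C) := by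
        gcongr
        calc (2 : ℝ) ^ j ≤ 2 ^ 3 := pow_le_pow_right₀ (by norm_num) hj
          _ = 8 := by norm_num

lemma derivBoundAt_const (c : ℝ) : DerivBoundAt (fun _ : M => c) x |c| := by
  refine ⟨contDiff_const, fun j _ => ?_⟩
  rcases Nat.eq_zero_or_pos j with rfl | hj
  · simp
  · rw [iteratedFDeriv_const_of_ne hj.ne']
    simp

lemma DerivBoundAt.const_mul (hf : DerivBoundAt f x B) (c : ℝ) :
    DerivBoundAt (fun y => c * f y) x (|c| * B) := by
  refine ⟨contDiff_const.mul hf.1, fun j hj => ?_⟩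
  have h2 : (fun y => c * f y) = c • f := rfl
  rw [h2, iteratedFDeriv_const_smul_apply (hf.1.of_le (by exact_mod_cast hj)).contDiffAt,
    norm_smul, Real.norm_eq_abs]
  exact mul_le_mul_of_nonneg_left (hf.2 j hj) (abs_nonneg c)

lemma derivBoundAt_sum {ι : Type*} (s : Finset ι) {F : ι → M → ℝ}
    (h : ∀ i ∈ s, DerivBoundAt (F i) x B) :
    DerivBoundAt (fun y => ∑ i ∈ s, F i y) x (s.card * B) := by
  classical
  induction s using Finset.induction_on with
  | empty => simpa using derivBoundAt_const (M := M) (x := x) 0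
  | insert a s ha ih =>
    simp only [Finset.sum_insert ha, Finset.card_insert_of_notMem ha]
    have h1 := (h a (by simp)).add (ih fun i hi => h i (by simp [hi]))
    refine h1.mono (le_of_eq ?_)
    push_cast
    ring

lemma derivBoundAt_clm (L : M →L[ℝ] ℝ) (hx : |L x| ≤ B) (hL : ‖L‖ ≤ B) :
    DerivBoundAt (fun y => L y) x B := by
  have hB : 0 ≤ B := (norm_nonneg _).trans hL
  refine ⟨L.contDiff, fun j _ => ?_⟩
  match j with
  | 0 => rw [norm_iteratedFDeriv_zero]; exact hx
  | 1 => rw [norm_iteratedFDeriv_one, ContinuousLinearMap.fderiv]; exact hL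
  | (j + 2) =>
    rw [← norm_iteratedFDeriv_fderiv]
    have h : (fderiv ℝ fun y => L y) = fun _ => L := funext fun _ => L.fderiv
    rw [h, iteratedFDeriv_const_of_ne (Nat.succ_ne_zero j)]
    simpa using hB

/-- The norm 2 allows for the difference of two node coordinates, and three derivatives cost 2³ = 8.
-/
lemma derivBoundAt_comp_clm_sub {E : Type*} [NormedAddCommGroup E] [NormedSpace ℝ E] {Φ : E → ℝ}
    (hΦ : ∀ x, DerivBoundAt Φ x B) (L : M →L[ℝ] E) (hL : ‖L‖ ≤ 2) (c : E) :
    DerivBoundAt (fun y => Φ (L y - c)) x (8 * B) := by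
  have hB := (hΦ 0).nonneg
  have hΦc : ContDiff ℝ 3 fun y => Φ (y - c) := (hΦ 0).1.comp (contDiff_id.sub contDiff_const)
  refine ⟨hΦc.comp L.contDiff, fun j hj => ?_⟩
  have heq : (fun y => Φ (L y - c)) = (fun y => Φ (y - c)) ∘ L := rfl
  rw [heq, L.iteratedFDeriv_comp_right hΦc x (by exact_mod_cast hj), iteratedFDeriv_comp_sub]
  refine (ContinuousMultilinearMap.norm_compContinuousLinearMap_le _ _).trans ?_
  rw [Finset.prod_const, Finset.card_univ, Fintype.card_fin, mul_comm]
  gcongr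
  · calc ‖L‖ ^ j ≤ 2 ^ j := by gcongr
      _ ≤ 2 ^ 3 := pow_le_pow_right₀ (by norm_num) hj
      _ = 8 := by norm_num
  · exact (hΦ _).2 j hj

end DerivBounds

/-! ### The loss as a function of the potential -/

section KernelLoss

variable {d k : ℕ}

/-- The regularized loss in terms of the radial potential `Φ`. -/
def kernelLoss (Φ : EuclideanSpace ℝ (Fin d) → ℝ) (w : Fin k → EuclideanSpace ℝ (Fin d))
    (b : Fin k → ℝ) (z : Params d k) : ℝ :=
  ((∑ i, ∑ j, z.fst i * z.fst j * Φ (z.snd i - z.snd j)) +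
    2 * ∑ i, ∑ j, z.fst i * b j * Φ (z.snd i - w j)) +
    ((∑ i, ∑ j, b i * b j * Φ (w i - w j)) + ∑ i, z.fst i * z.fst i)

variable {σ : EuclideanSpace ℝ (Fin d) → EuclideanSpace ℝ (Fin d) → ℝ}
  {Φ : EuclideanSpace ℝ (Fin d) → ℝ}

lemma integrable_activation_mul (hσ : ∀ w, MemLp (fun x => σ x w) 2
    (stdGaussian (EuclideanSpace ℝ (Fin d)))) (θ w : EuclideanSpace ℝ (Fin d)) :
    Integrable (fun x => σ x θ * σ x w) (stdGaussian (EuclideanSpace ℝ (Fin d))) :=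
        (hσ θ).integrable_mul (hσ w)

lemma integral_sum_mul_sum (hσ : ∀ w, MemLp (fun x => σ x w) 2
    (stdGaussian (EuclideanSpace ℝ (Fin d))))
    (a b : Fin k → ℝ) (θ w : Fin k → EuclideanSpace ℝ (Fin d)) :
    ∫ x, (∑ i, a i * σ x (θ i)) * (∑ j, b j * σ x (w j)) ∂(stdGaussian (EuclideanSpace ℝ (Fin d))) =
      ∑ i, ∑ j, a i * b j * potential σ (θ i) (w j) := by
  have h1 : ∀ x, (∑ i, a i * σ x (θ i)) * (∑ j, b j * σ x (w j)) =
      ∑ i, ∑ j, a i * b j * (σ x (θ i) * σ x (w j)) := by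
    intro x
    rw [Finset.sum_mul_sum]
    exact Finset.sum_congr rfl fun i _ => Finset.sum_congr rfl fun j _ => by ring
  simp_rw [h1]
  rw [integral_finsetSum _ fun i _ => integrable_finsetSum _ fun j _ =>
    (integrable_activation_mul hσ (θ i) (w j)).const_mul _]
  refine Finset.sum_congr rfl fun i _ => ?_
  rw [integral_finsetSum _ fun j _ => (integrable_activation_mul hσ (θ i) (w j)).const_mul _]
  refine Finset.sum_congr rfl fun j _ => ?_
  rw [integral_const_mul, potential]

lemma memLp_sum_activation (hσ : ∀ w, MemLp (fun x => σ x w) 2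
    (stdGaussian (EuclideanSpace ℝ (Fin d))))
    (a : Fin k → ℝ) (θ : Fin k → EuclideanSpace ℝ (Fin d)) :
    MemLp (fun x => ∑ i, a i * σ x (θ i)) 2 (stdGaussian (EuclideanSpace ℝ (Fin d))) :=
  memLp_finsetSum _ fun i _ => (hσ (θ i)).const_mul (a i)

/-- The potential is a Gram kernel: the double sum is the second moment of the network output. -/
lemma sum_sum_mul_potential_nonneg (hσ : ∀ w, MemLp (fun x => σ x w) 2
    (stdGaussian (EuclideanSpace ℝ (Fin d))))
    (a : Fin k → ℝ) (θ : Fin k → EuclideanSpace ℝ (Fin d)) : 0 ≤ ∑ i, ∑ j, a i * a j * potential σ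
    (θ i) (θ j) := by
  rw [← integral_sum_mul_sum hσ]
  exact integral_nonneg fun x => mul_self_nonneg _

/-- Expanding the square leaves only pairwise correlations of activations. The loss is therefore as
smooth as the potential, whatever the regularity of the activation. -/
theorem regLoss_eq_kernelLoss (hσ : ∀ w, MemLp (fun x => σ x w) 2
    (stdGaussian (EuclideanSpace ℝ (Fin d))))
    (hΦ : ∀ θ w, potential σ θ w = Φ (θ - w)) (w : Fin k → EuclideanSpace ℝ (Fin d))
    (b : Fin k → ℝ) :
    regLoss σ w b = kernelLoss Φ w b := by
  funext z
  have hA := memLp_sum_activation hσ z.fst.ofLp z.snd.ofLp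
  have hB := memLp_sum_activation hσ b w
  have h1 : ∀ x, (∑ i, z.fst i * σ x (z.snd i) + ∑ j, b j * σ x (w j)) ^ 2 =
      ((∑ i, z.fst i * σ x (z.snd i)) * (∑ i, z.fst i * σ x (z.snd i)) +
        2 * ((∑ i, z.fst i * σ x (z.snd i)) * ∑ j, b j * σ x (w j))) +
      (∑ j, b j * σ x (w j)) * ∑ j, b j * σ x (w j) := fun x => by ring
  rw [regLoss, squaredLoss]
  simp_rw [h1]
  rw [integral_add, integral_add, integral_const_mul, integral_sum_mul_sum hσ,
    integral_sum_mul_sum hσ, integral_sum_mul_sum hσ, kernelLoss, EuclideanSpace.norm_sq_eq]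
  · simp_rw [hΦ, Real.norm_eq_abs, sq_abs, sq]
    ring
  · exact hA.integrable_mul hA
  · exact (hA.integrable_mul hB).const_mul _
  · exact (hA.integrable_mul hA).add ((hA.integrable_mul hB).const_mul _)
  · exact hB.integrable_mul hB

variable (d k) in
/-- The coordinate `a_i` of the parameters. -/
def weightCLM (i : Fin k) : Params d k →L[ℝ] ℝ :=
  (EuclideanSpace.proj i : EuclideanSpace ℝ (Fin k) →L[ℝ] ℝ).comp
    (WithLp.fstL 2 ℝ (EuclideanSpace ℝ (Fin k)) (PiLp 2 fun _ : Fin k => EuclideanSpace ℝ (Fin d)))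

variable (d k) in
/-- The coordinate `θ_i` of the parameters. -/
def nodeCLM (i : Fin k) : Params d k →L[ℝ] EuclideanSpace ℝ (Fin d) :=
  (PiLp.proj 2 (fun _ : Fin k => EuclideanSpace ℝ (Fin d)) i :
      (PiLp 2 fun _ : Fin k => EuclideanSpace ℝ (Fin d)) →L[ℝ] EuclideanSpace ℝ (Fin d)).comp
    (WithLp.sndL 2 ℝ (EuclideanSpace ℝ (Fin k)) (PiLp 2 fun _ : Fin k => EuclideanSpace ℝ (Fin d)))

lemma norm_fst_le_norm (z : Params d k) : ‖z.fst‖ ≤ ‖z‖ := by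
  rw [WithLp.prod_norm_eq_of_L2]
  exact Real.le_sqrt_of_sq_le (by nlinarith [sq_nonneg ‖z.snd‖])

lemma norm_snd_le_norm (z : Params d k) : ‖z.snd‖ ≤ ‖z‖ := by
  rw [WithLp.prod_norm_eq_of_L2]
  exact Real.le_sqrt_of_sq_le (by nlinarith [sq_nonneg ‖z.fst‖])

lemma norm_weightCLM_le (i : Fin k) : ‖weightCLM d k i‖ ≤ 1 :=
  ContinuousLinearMap.opNorm_le_bound _ zero_le_one fun z => by
    rw [one_mul]; exact (PiLp.norm_apply_le z.fst i).trans (norm_fst_le_norm z)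

lemma norm_nodeCLM_le (i : Fin k) : ‖nodeCLM d k i‖ ≤ 1 :=
  ContinuousLinearMap.opNorm_le_bound _ zero_le_one fun z => by
    rw [one_mul]; exact (PiLp.norm_apply_le z.snd i).trans (norm_snd_le_norm z)

/-- Bounds for the derivatives of the loss on a region where the weights are bounded by `A`. -/
theorem derivBoundAt_kernelLoss {B A : ℝ} (hB : 1 ≤ B) (hA : 1 ≤ A) (hk : 1 ≤ k)
    (hΦ : ∀ x, DerivBoundAt Φ x B) (w : Fin k → EuclideanSpace ℝ (Fin d)) {b : Fin k → ℝ}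
    (hb : ∀ j, |b j| ≤ 1)
    {z : Params d k} (hz : ‖z.fst‖ ≤ A) :
    DerivBoundAt (kernelLoss Φ w b) z (1000 * k ^ 2 * A ^ 2 * B) := by
  have ha : ∀ i, DerivBoundAt (fun z : Params d k => z.fst i) z A := fun i =>
    derivBoundAt_clm (weightCLM d k i) ((PiLp.norm_apply_le z.fst i).trans hz)
      ((norm_weightCLM_le i).trans hA)
  have h1 : ∀ i j, DerivBoundAt (fun z : Params d k => Φ (z.snd i - z.snd j)) z (8 * B) := by
    intro i j
    have := derivBoundAt_comp_clm_sub hΦ (x := z) (nodeCLM d k i - nodeCLM d k j) (by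
      have h1 := norm_sub_le (nodeCLM d k i) (nodeCLM d k j)
      have h2 := norm_nodeCLM_le (d := d) i
      have h3 := norm_nodeCLM_le (d := d) j
      linarith) 0
    simp only [sub_zero] at this
    exact this
  have h2 : ∀ i j, DerivBoundAt (fun z : Params d k => Φ (z.snd i - w j)) z (8 * B) := fun i j =>
    derivBoundAt_comp_clm_sub hΦ (x := z) (nodeCLM d k i)
      ((norm_nodeCLM_le i).trans (by norm_num)) (w j)
  have t1 := derivBoundAt_sum Finset.univ fun i _ => derivBoundAt_sum Finset.univ fun j _ =>
    ((ha i).mul (ha j)).mul (h1 i j)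
  have t2 : DerivBoundAt (fun z : Params d k => ∑ i, ∑ j, z.fst i * b j * Φ (z.snd i - w j)) z
      ((Finset.univ : Finset (Fin k)).card * ((Finset.univ : Finset (Fin k)).card *
        (8 * (A * (8 * B))))) := by
    refine derivBoundAt_sum Finset.univ fun i _ => derivBoundAt_sum Finset.univ fun j _ => ?_
    have := ((ha i).mul (h2 i j)).const_mul (b j)
    have h3 : (fun z : Params d k => z.fst i * b j * Φ (z.snd i - w j)) =
        fun z : Params d k => b j * (z.fst i * Φ (z.snd i - w j)) := by funext z; ring
    rw [h3]
    exact this.mono (mul_le_of_le_one_left (by positivity) (hb j))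
  have t3 : DerivBoundAt (fun _ : Params d k => ∑ i, ∑ j, b i * b j * Φ (w i - w j)) z
      ((Finset.univ : Finset (Fin k)).card * ((Finset.univ : Finset (Fin k)).card * B)) := by
    refine derivBoundAt_sum Finset.univ fun i _ => derivBoundAt_sum Finset.univ fun j _ => ?_
    refine (derivBoundAt_const _).mono ?_
    rw [abs_mul, abs_mul]
    have h3 := (hΦ (w i - w j)).2 0 (by norm_num)
    rw [norm_iteratedFDeriv_zero, Real.norm_eq_abs] at h3
    calc |b i| * |b j| * |Φ (w i - w j)| ≤ 1 * 1 * B := by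
          gcongr
          · exact hb i
          · exact hb j
      _ = B := by ring
  have t4 := derivBoundAt_sum Finset.univ fun i _ => (ha i).mul (ha i)
  -- The four groups of terms contribute 512, 128, 1 and 8 times at most k²A²B, in total less than
  -- 1000.
  have t := (t1.add (t2.const_mul 2)).add (t3.add t4)
  refine DerivBoundAt.mono t ?_
  simp only [Finset.card_univ, Fintype.card_fin, Nat.abs_ofNat]
  have hk' : (1 : ℝ) ≤ k := by exact_mod_cast hk
  have e1 : A * B * (k : ℝ) ^ 2 ≤ k ^ 2 * A ^ 2 * B := by
    have : A ≤ A ^ 2 := by nlinarith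
    have : A * (B * (k : ℝ) ^ 2) ≤ A ^ 2 * (B * (k : ℝ) ^ 2) := by gcongr
    linarith
  have e2 : B * (k : ℝ) ^ 2 ≤ k ^ 2 * A ^ 2 * B := by
    have : 1 * (B * (k : ℝ) ^ 2) ≤ A ^ 2 * (B * (k : ℝ) ^ 2) := by
      gcongr; nlinarith
    linarith
  have e3 : k * A ^ 2 ≤ k ^ 2 * A ^ 2 * B := by
    have h5 : (k : ℝ) * 1 ≤ k ^ 2 * B := by
      gcongr; nlinarith
    have : (k : ℝ) * 1 * A ^ 2 ≤ k ^ 2 * B * A ^ 2 := by gcongr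
    linarith
  have e4 : 0 ≤ (k : ℝ) ^ 2 * A ^ 2 * B := by positivity
  nlinarith

end KernelLoss

/-! ### Negative curvature of the loss away from the targets -/

section Landscape

variable {d k : ℕ} {Φ : EuclideanSpace ℝ (Fin d) → ℝ} {w : Fin k → EuclideanSpace ℝ (Fin d)}
  {b : Fin k → ℝ} {z : Params d k}

variable (d k) in
/-- The simultaneous translation of all nodes. -/
def translateCLM : EuclideanSpace ℝ (Fin d) →L[ℝ] Params d k :=
  ((WithLp.prodContinuousLinearEquiv 2 ℝ (EuclideanSpace ℝ (Fin k))
      (PiLp 2 fun _ : Fin k => EuclideanSpace ℝ (Fin d))).symm : _ →L[ℝ] Params d k).comp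
    ((ContinuousLinearMap.inr ℝ (EuclideanSpace ℝ (Fin k))
      (PiLp 2 fun _ : Fin k => EuclideanSpace ℝ (Fin d))).comp
      (((PiLp.continuousLinearEquiv 2 ℝ fun _ : Fin k => EuclideanSpace ℝ (Fin d)).symm :
        (Fin k → EuclideanSpace ℝ (Fin d)) →L[ℝ] PiLp 2 fun _ : Fin k =>
          EuclideanSpace ℝ (Fin d)).comp
        (ContinuousLinearMap.pi fun _ => ContinuousLinearMap.id ℝ (EuclideanSpace ℝ (Fin d)))))

lemma fst_add_translate (z : Params d k) (u : EuclideanSpace ℝ (Fin d)) :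
    (z + translateCLM d k u).fst = z.fst := by
  change z.fst + 0 = z.fst
  rw [add_zero]

lemma snd_add_translate (z : Params d k) (u : EuclideanSpace ℝ (Fin d)) (i : Fin k) :
    (z + translateCLM d k u).snd i = z.snd i + u := rfl

lemma norm_sq_translate (u : EuclideanSpace ℝ (Fin d)) :
    ‖translateCLM d k u‖ ^ 2 = k * ‖u‖ ^ 2 := by
  rw [WithLp.prod_norm_sq_eq_of_L2]
  change ‖(0 : EuclideanSpace ℝ (Fin k))‖ ^ 2 +
    ‖(WithLp.toLp 2 fun _ : Fin k => u : PiLp 2 fun _ : Fin k => EuclideanSpace ℝ (Fin d))‖ ^ 2 = _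
  have h := PiLp.norm_sq_eq_of_L2 (fun _ : Fin k => EuclideanSpace ℝ (Fin d))
    (WithLp.toLp 2 fun _ : Fin k => u)
  simp only [Finset.sum_const, Finset.card_univ, Fintype.card_fin, nsmul_eq_mul] at h
  rw [h, norm_zero]
  ring

lemma laplacian_const_add_sum {E ι : Type*} [NormedAddCommGroup E] [InnerProductSpace ℝ E]
    [FiniteDimensional ℝ E] {Φ : E → ℝ} (hΦ : ContDiff ℝ 2 Φ) (s : Finset ι) (c₀ : ℝ) (c : ι → ℝ)
    (v : ι → E) (x : E) :
    Laplacian.laplacian (fun u => c₀ + ∑ p ∈ s, c p * Φ (u - v p)) x =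
      ∑ p ∈ s, c p * Laplacian.laplacian Φ (x - v p) := by
  classical
  have hc : ∀ p, ContDiff ℝ 2 fun u => c p * Φ (u - v p) := fun p =>
    contDiff_const.mul (hΦ.comp (contDiff_id.sub contDiff_const))
  induction s using Finset.induction_on with
  | empty => simp
  | insert a s ha ih =>
    have h1 : (fun u => c₀ + ∑ p ∈ insert a s, c p * Φ (u - v p)) =
        (c a • fun u => Φ (u - v a)) + fun u => c₀ + ∑ p ∈ s, c p * Φ (u - v p) := by
      funext u
      simp only [Finset.sum_insert ha, Pi.add_apply, Pi.smul_apply, smul_eq_mul]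
      ring
    have h2 : ContDiff ℝ 2 fun u => c₀ + ∑ p ∈ s, c p * Φ (u - v p) :=
      contDiff_const.add (ContDiff.sum fun p _ => hc p)
    have h3 : ContDiff ℝ 2 fun u => Φ (u - v a) := hΦ.comp (contDiff_id.sub contDiff_const)
    have h4 : ContDiff ℝ 2 (c a • fun u => Φ (u - v a)) := h3.const_smul (c a)
    rw [h1, ContDiffAt.laplacian_add h4.contDiffAt h2.contDiffAt, ih, Finset.sum_insert ha,
      InnerProductSpace.laplacian_smul _ h3.contDiffAt, laplacian_comp_sub_const, smul_eq_mul]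

/-- The trace of the Hessian of the loss over the simultaneous translations of the nodes. -/
lemma sum_iteratedFDeriv_translate (hΦ : ContDiff ℝ 2 Φ) (hG : ContDiff ℝ 2 (kernelLoss Φ w b)) :
    ∑ l : Fin d, iteratedFDeriv ℝ 2 (kernelLoss Φ w b) z
      ![translateCLM d k (EuclideanSpace.basisFun (Fin d) ℝ l),
        translateCLM d k (EuclideanSpace.basisFun (Fin d) ℝ l)] =
    2 * ∑ i, ∑ j, z.fst i * b j * Laplacian.laplacian Φ (z.snd i - w j) := by
  set G := kernelLoss Φ w b
  set T := translateCLM d k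
  have h1 : Laplacian.laplacian (fun u => G (z + T u)) 0 =
      ∑ l : Fin d, iteratedFDeriv ℝ 2 G z ![T (EuclideanSpace.basisFun (Fin d) ℝ l),
        T (EuclideanSpace.basisFun (Fin d) ℝ l)] := by
    rw [InnerProductSpace.laplacian_eq_iteratedFDeriv_orthonormalBasis _
      (EuclideanSpace.basisFun (Fin d) ℝ)]
    refine Finset.sum_congr rfl fun l _ => ?_
    have h2 : (fun u => G (z + T u)) = (fun y => G (z + y)) ∘ T := rfl
    rw [h2, T.iteratedFDeriv_comp_right
      (show ContDiff ℝ 2 fun y => G (z + y) from hG.comp (contDiff_const.add contDiff_id)) 0 le_rfl,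
      iteratedFDeriv_comp_add_left, map_zero, add_zero,
      ContinuousMultilinearMap.compContinuousLinearMap_apply]
    congr 1
    ext i
    fin_cases i <;> rfl
  rw [← h1]
  -- A common translation preserves the differences of the nodes, so only the cross terms with the
  -- targets depend on u.
  have h3 : (fun u => G (z + T u)) = fun u =>
      ((∑ i, ∑ j, z.fst i * z.fst j * Φ (z.snd i - z.snd j)) +
        ((∑ i, ∑ j, b i * b j * Φ (w i - w j)) + ∑ i, z.fst i * z.fst i)) +
      ∑ p : Fin k × Fin k, (2 * (z.fst p.1 * b p.2)) * Φ (u - (w p.2 - z.snd p.1)) := by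
    funext u
    simp only [G, T, kernelLoss, fst_add_translate, snd_add_translate, add_sub_add_right_eq_sub]
    rw [Fintype.sum_prod_type]
    have h4 : ∀ i j, z.snd i + u - w j = u - (w j - z.snd i) := fun i j => by abel
    simp_rw [h4, Finset.mul_sum, ← mul_assoc]
    ring
  rw [h3, laplacian_const_add_sum hΦ, Fintype.sum_prod_type]
  simp_rw [zero_sub, neg_sub, Finset.mul_sum, mul_assoc]

lemma fst_add_smul_weights (t : ℝ) (i : Fin k) :
    (z + t • (WithLp.toLp 2 (z.fst, 0) : Params d k)).fst i = (1 + t) * z.fst i := by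
  change z.fst i + t * z.fst i = _
  ring

lemma snd_add_smul_weights (t : ℝ) (i : Fin k) :
    (z + t • (WithLp.toLp 2 (z.fst, 0) : Params d k)).snd i = z.snd i := by
  change z.snd i + t • (0 : EuclideanSpace ℝ (Fin d)) = _
  rw [smul_zero, add_zero]

lemma kernelLoss_add_smul_weights (t : ℝ) :
    kernelLoss Φ w b (z + t • (WithLp.toLp 2 (z.fst, 0) : Params d k)) =
      (1 + t) ^ 2 * (∑ i, ∑ j, z.fst i * z.fst j * Φ (z.snd i - z.snd j)) +
      2 * ((1 + t) * ∑ i, ∑ j, z.fst i * b j * Φ (z.snd i - w j)) +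
      ((∑ i, ∑ j, b i * b j * Φ (w i - w j)) + (1 + t) ^ 2 * ‖z.fst‖ ^ 2) := by
  simp only [kernelLoss, fst_add_smul_weights, snd_add_smul_weights, EuclideanSpace.norm_sq_eq,
    Finset.mul_sum, Real.norm_eq_abs, sq_abs]
  congr 2
  · exact Finset.sum_congr rfl fun i _ => Finset.sum_congr rfl fun j _ => by ring
  · exact Finset.sum_congr rfl fun i _ => Finset.sum_congr rfl fun j _ => by ring
  · exact Finset.sum_congr rfl fun i _ => by ring

lemma hasDerivAt_rescaled_loss (Q P B N : ℝ) :
    HasDerivAt (fun t : ℝ => (1 + t) ^ 2 * Q + 2 * ((1 + t) * P) + (B + (1 + t) ^ 2 * N))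
      (2 * Q + 2 * P + 2 * N) 0 := by
  have h8 : HasDerivAt (fun t : ℝ => 1 + t) 1 0 := (hasDerivAt_id 0).const_add 1
  have h9 := (((h8.pow 2).mul_const Q).add ((h8.mul_const P).const_mul 2)).add
    (((h8.pow 2).mul_const N).const_add B)
  exact HasDerivAt.congr_deriv h9 (by norm_num)

lemma hasDerivAt_comp_line {E : Type*} [NormedAddCommGroup E] [NormedSpace ℝ E] {f : E → ℝ}
    {x : E} (hf : DifferentiableAt ℝ f x) (v : E) :
    HasDerivAt (fun t : ℝ => f (x + t • v)) (fderiv ℝ f x v) 0 := by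
  have h2 : HasDerivAt (fun t : ℝ => x + t • v) v 0 := by
    simpa using ((hasDerivAt_id (0 : ℝ)).smul_const v).const_add x
  have h3 : HasFDerivAt f (fderiv ℝ f x) (x + (0 : ℝ) • v) := by
    rw [zero_smul, add_zero]
    exact hf.hasFDerivAt
  exact h3.comp_hasDerivAt 0 h2

/-- The derivative of the loss in the direction of the weights. -/
lemma fderiv_kernelLoss_weights (hG : ContDiff ℝ 2 (kernelLoss Φ w b)) :
    fderiv ℝ (kernelLoss Φ w b) z (WithLp.toLp 2 (z.fst, 0)) =
      2 * (∑ i, ∑ j, z.fst i * z.fst j * Φ (z.snd i - z.snd j)) +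
      2 * (∑ i, ∑ j, z.fst i * b j * Φ (z.snd i - w j)) + 2 * ‖z.fst‖ ^ 2 := by
  have h1 := hasDerivAt_comp_line (hG.differentiable (by norm_num) z)
    (WithLp.toLp 2 (z.fst, 0) : Params d k)
  simp only [kernelLoss_add_smul_weights] at h1
  exact h1.unique (hasDerivAt_rescaled_loss _ _ _ _)

/-- Away from the targets, an approximate critical point with nonzero weights has a direction of
negative curvature. -/
theorem lambdaMin_hessian_kernelLoss_le {ε : ℝ} (hΦ : ContDiff ℝ 2 Φ)
    (hG : ContDiff ℝ 2 (kernelLoss Φ w b))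
    (hΔ : ∀ y, ε ≤ ‖y‖ → Laplacian.laplacian Φ y = Φ y)
    (hpos : 0 ≤ ∑ i, ∑ j, z.fst i * z.fst j * Φ (z.snd i - z.snd j))
    (hfar : ∀ i j, ε ≤ ‖z.snd i - w j‖)
    (hgrad : ‖gradient (kernelLoss Φ w b) z‖ ≤ ‖z.fst‖) :
    lambdaMin (hessian (kernelLoss Φ w b) z) * (k * d) ≤ -‖z.fst‖ ^ 2 := by
  set G := kernelLoss Φ w b
  -- Translating all k nodes by a unit vector is a displacement of squared norm k, which gives the
  -- factor k in the Rayleigh bound.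
  have h1 : ∀ l : Fin d, lambdaMin (hessian G z) * k ≤ iteratedFDeriv ℝ 2 G z
      ![translateCLM d k (EuclideanSpace.basisFun (Fin d) ℝ l),
        translateCLM d k (EuclideanSpace.basisFun (Fin d) ℝ l)] := by
    intro l
    have h := lambdaMin_mul_norm_sq_le (isSymmetric_hessian hG.contDiffAt (x := z))
      (translateCLM d k (EuclideanSpace.basisFun (Fin d) ℝ l))
    rw [norm_sq_translate, OrthonormalBasis.norm_eq_one, one_pow, mul_one,
      inner_hessian hG.contDiffAt] at h
    exact h
  have h2 := Finset.sum_le_sum fun l (_ : l ∈ Finset.univ) => h1 l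
  rw [sum_iteratedFDeriv_translate hΦ hG] at h2
  simp_rw [hΔ _ (hfar _ _)] at h2
  have h3 := fderiv_kernelLoss_weights (z := z) hG
  have h4 : fderiv ℝ G z (WithLp.toLp 2 (z.fst, 0)) ≤ ‖z.fst‖ ^ 2 := by
    rw [← inner_gradient_left]
    refine (real_inner_le_norm _ _).trans ?_
    have h5 : ‖(WithLp.toLp 2 (z.fst, 0) : Params d k)‖ = ‖z.fst‖ := by
      rw [WithLp.prod_norm_eq_of_L2]
      simp
    rw [h5, sq]
    gcongr
  simp only [Finset.sum_const, Finset.card_univ, Fintype.card_fin, nsmul_eq_mul] at h2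
  -- With P and Q the cross and self terms, `h2` says that the eigenvalue times kd is at most 2P,
  -- while `h3`, `h4` and `hpos` give 2P ≤ -‖a‖².
  linarith

lemma abs_cross_term_le {B : ℝ} (hB : ∀ y, |Φ y| ≤ B) (hb : ∀ j, |b j| ≤ 1) :
    |∑ i, ∑ j, z.fst i * b j * Φ (z.snd i - w j)| ≤ k ^ 2 * B * ‖z.fst‖ := by
  have hB0 : 0 ≤ B := (abs_nonneg _).trans (hB 0)
  calc |∑ i, ∑ j, z.fst i * b j * Φ (z.snd i - w j)|
      ≤ ∑ i, |∑ j, z.fst i * b j * Φ (z.snd i - w j)| := Finset.abs_sum_le_sum_abs _ _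
    _ ≤ ∑ i, ∑ j, |z.fst i * b j * Φ (z.snd i - w j)| :=
        Finset.sum_le_sum fun i _ => Finset.abs_sum_le_sum_abs _ _
    _ ≤ ∑ _i : Fin k, ∑ _j : Fin k, ‖z.fst‖ * 1 * B := by
        refine Finset.sum_le_sum fun i _ => Finset.sum_le_sum fun j _ => ?_
        rw [abs_mul, abs_mul]
        gcongr
        · exact PiLp.norm_apply_le z.fst i
        · exact hb j
        · exact hB _
    _ = k ^ 2 * B * ‖z.fst‖ := by
        simp only [Finset.sum_const, Finset.card_univ, Fintype.card_fin, nsmul_eq_mul]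
        ring

lemma target_term_le {B : ℝ} (hB : ∀ y, |Φ y| ≤ B) (hb : ∀ j, |b j| ≤ 1) :
    ∑ i, ∑ j, b i * b j * Φ (w i - w j) ≤ k ^ 2 * B := by
  calc ∑ i, ∑ j, b i * b j * Φ (w i - w j) ≤ ∑ _i : Fin k, ∑ _j : Fin k, 1 * 1 * B := by
        refine Finset.sum_le_sum fun i _ => Finset.sum_le_sum fun j _ => ?_
        refine (le_abs_self _).trans ?_
        rw [abs_mul, abs_mul]
        gcongr
        · exact hb i
        · exact hb j
        · exact hB _
    _ = k ^ 2 * B := by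
        simp only [Finset.sum_const, Finset.card_univ, Fintype.card_fin, nsmul_eq_mul]
        ring

/-- With one active unit at the origin, the loss and the regularizer each contribute t². Writing S
for the sum of b_j Φ(-w_j), the minimum over t is at -S/2 and lies S²/2 below the loss of the zero
weights. -/
lemma kernelLoss_mkParams_single (hΦ0 : Φ 0 = 1) (i₀ : Fin k) (t : ℝ) :
    kernelLoss Φ w b (mkParams (Pi.single i₀ t) fun _ => 0) =
      2 * t ^ 2 + 2 * (t * ∑ j, b j * Φ (-w j)) + ∑ i, ∑ j, b i * b j * Φ (w i - w j) := by
  have h1 : ∀ i, (mkParams (d := d) (Pi.single i₀ t) fun _ => 0).fst i =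
      (Pi.single i₀ t : Fin k → ℝ) i := fun i => rfl
  have h2 : ∀ i, (mkParams (d := d) (Pi.single i₀ t) fun _ => 0).snd i = 0 := fun i => rfl
  simp only [kernelLoss, h1, h2, Pi.single_apply, ite_mul, mul_ite, zero_mul, mul_zero,
    Finset.sum_ite_eq', Finset.mem_univ, if_true, sub_self, hΦ0, zero_sub, mul_one]
  rw [Finset.sum_comm]
  simp only [Finset.sum_ite_eq', Finset.mem_univ, if_true, Finset.mul_sum]
  simp only [mul_assoc]
  ring

end Landscape

/-! ### The run for a fixed target network -/

section Run

variable {d k : ℕ} {Φ : EuclideanSpace ℝ (Fin d) → ℝ} {w : Fin k → EuclideanSpace ℝ (Fin d)}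
  {b : Fin k → ℝ} {z : Params d k}

lemma norm_fst_sq_le_regLoss (σ : EuclideanSpace ℝ (Fin d) → EuclideanSpace ℝ (Fin d) → ℝ)
    (w : Fin k → EuclideanSpace ℝ (Fin d)) (b : Fin k → ℝ) (z : Params d k) :
    ‖z.fst‖ ^ 2 ≤ regLoss σ w b z :=
  le_add_of_nonneg_left (integral_nonneg fun _ => sq_nonneg _)

/-- Points whose loss is below that of the zero weights by `S` have weights bounded below. -/
lemma le_norm_fst_of_kernelLoss_le {B S : ℝ} (hk : 1 ≤ k) (hB1 : 0 < B) (hB : ∀ y, |Φ y| ≤ B)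
    (hb : ∀ j, |b j| ≤ 1)
    (hpos : 0 ≤ ∑ i, ∑ j, z.fst i * z.fst j * Φ (z.snd i - z.snd j))
    (hz : kernelLoss Φ w b z ≤ (∑ i, ∑ j, b i * b j * Φ (w i - w j)) - S) :
    S / (2 * k ^ 2 * B) ≤ ‖z.fst‖ := by
  have h1 := (abs_le.1 (abs_cross_term_le (z := z) (w := w) hB hb)).1
  have h2 : 0 ≤ ∑ i, z.fst i * z.fst i := Finset.sum_nonneg fun i _ => mul_self_nonneg _
  have hk' : (0 : ℝ) < k := by exact_mod_cast hk
  rw [div_le_iff₀ (by positivity)]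
  simp only [kernelLoss] at hz
  linarith

/-- On the sublevel set of the start, the weights have norm between `η` and kM. The lower bound
turns a gradient smaller than `η` into negative curvature, and the upper bound controls the
derivatives. The parameters `α`, `η`, `γ` depend on the target only through the threshold `S₀`. -/
theorem exists_secondGD_run (hd : 1 ≤ d) (hk : 1 ≤ k) {ε M S₀ : ℝ} (hM : 1 ≤ M)
    (hΦ : ∀ x, DerivBoundAt Φ x M) (hΦ0 : Φ 0 = 1)
    (hΔ : ∀ y, ε ≤ ‖y‖ → Laplacian.laplacian Φ y = Φ y)
    {σ : EuclideanSpace ℝ (Fin d) → EuclideanSpace ℝ (Fin d) → ℝ}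
    (hσ : ∀ w, MemLp (fun x => σ x w) 2 (stdGaussian (EuclideanSpace ℝ (Fin d))))
    (hpot : ∀ θ w, potential σ θ w = Φ (θ - w)) (hS₀ : 0 < S₀) (hb : ∀ j, |b j| ≤ 1)
    (hS : S₀ ≤ |∑ j, b j * Φ (-w j)|) {α η γ : ℝ} (hα : α = 1 / (2 * (4000 * k ^ 4 * M ^ 3)))
    (hη : η = S₀ ^ 2 / (4 * k ^ 2 * M)) (hγ : γ = η ^ 2 / (2 * k * d)) :
    ∃ a₀ : Fin k → ℝ, ∀ v : Params d k → Params d k,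
      IsMinEigenvectorRule (regLoss σ w b) v →
      ∃ (N : ℕ) (out : Params d k),
        (N : ℝ) ≤ k ^ 2 * M / min (α * η ^ 2 / 2) (α ^ 2 * γ ^ 3 / 2) + 1 ∧
        SecondGDReturns (regLoss σ w b) v α η γ (mkParams a₀ fun _ => 0) N out ∧
        ∃ i j : Fin k, ‖out.snd i - w j‖ < ε := by
  have hG := regLoss_eq_kernelLoss hσ hpot w b
  have hk' : (1 : ℝ) ≤ k := by exact_mod_cast hk
  have hd' : (1 : ℝ) ≤ d := by exact_mod_cast hd
  have hM0 : 0 < M := by linarith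
  have hΦM : ∀ y, |Φ y| ≤ M := fun y => by
    have := (hΦ y).2 0 (by norm_num)
    rwa [norm_iteratedFDeriv_zero, Real.norm_eq_abs] at this
  have hη0 : 0 < η := by rw [hη]; positivity
  have hγ0 : 0 < γ := by rw [hγ]; positivity
  have hα0 : 0 < α := by rw [hα]; positivity
  set S := ∑ j, b j * Φ (-w j) with hSdef
  set T := ∑ i, ∑ j, b i * b j * Φ (w i - w j) with hT
  have hpos : ∀ z : Params d k, 0 ≤ ∑ i, ∑ j, z.fst i * z.fst j * Φ (z.snd i - z.snd j) :=
    fun z => by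
      have := sum_sum_mul_potential_nonneg hσ z.fst.ofLp z.snd.ofLp
      simp_rw [hpot] at this
      exact this
  have hGc : ContDiff ℝ 3 (regLoss σ w b) := by
    rw [hG]
    exact (derivBoundAt_kernelLoss (z := 0) hM le_rfl hk hΦ w hb (by simp)).1
  have hx₀ : regLoss σ w b (mkParams (Pi.single (⟨0, hk⟩ : Fin k) (-S / 2)) fun _ => 0) =
      T - S ^ 2 / 2 := by
    rw [hG, kernelLoss_mkParams_single hΦ0]
    ring
  have hx₀le : regLoss σ w b (mkParams (Pi.single (⟨0, hk⟩ : Fin k) (-S / 2)) fun _ => 0) ≤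
      k ^ 2 * M := by
    rw [hx₀]
    have := target_term_le (w := w) hΦM hb
    have := sq_nonneg S
    linarith
  have hSS : S₀ ^ 2 ≤ S ^ 2 := by
    rw [← sq_abs S]
    gcongr
  have ha : ∀ z, regLoss σ w b z ≤
      regLoss σ w b (mkParams (Pi.single (⟨0, hk⟩ : Fin k) (-S / 2)) fun _ => 0) →
      η ≤ ‖z.fst‖ ∧ ‖z.fst‖ ≤ k * M := by
    intro z hz
    constructor
    · have hz' := hz
      rw [hx₀, hG] at hz'
      refine le_trans ?_ (le_norm_fst_of_kernelLoss_le hk hM0 hΦM hb (hpos z) hz')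
      have h1 : η = S₀ ^ 2 / 2 / (2 * k ^ 2 * M) := by
        rw [hη, div_div]
        congr 1
        ring
      rw [h1]
      gcongr
    · refine abs_le_of_sq_le_sq' ?_ (by positivity) |>.2
      calc ‖z.fst‖ ^ 2 ≤ k ^ 2 * M := (norm_fst_sq_le_regLoss σ w b z).trans (hz.trans hx₀le)
        _ ≤ k ^ 2 * M ^ 2 := by gcongr; nlinarith
        _ = (k * M) ^ 2 := by ring
  refine ⟨Pi.single (⟨0, hk⟩ : Fin k) (-S / 2), fun v hv => ?_⟩
  -- Within distance 1 of the sublevel set the weights have norm at most kM + 1 ≤ 2kM, and inserting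
  -- 2kM for the weight bound in `derivBoundAt_kernelLoss` gives K = 4000 k⁴M³.
  have hkM : 1 ≤ k * M := by nlinarith
  obtain ⟨N, out, h1, h2, h3⟩ := exists_secondGDReturns (K := 4000 * k ^ 4 * M ^ 3)
    (good := fun z => ∃ i j : Fin k, ‖z.snd i - w j‖ < ε)
    (x₀ := mkParams (Pi.single (⟨0, hk⟩ : Fin k) (-S / 2)) fun _ => 0) hGc
    (fun z => (sq_nonneg _).trans (norm_fst_sq_le_regLoss σ w b z))
    (by
      have h1 : (1 : ℝ) ≤ k ^ 4 := one_le_pow₀ hk'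
      have h2 : (1 : ℝ) ≤ M ^ 3 := one_le_pow₀ hM
      nlinarith) hα hη0 hγ0
    (by
      intro z hz p hp j _ hj
      have h1 : ‖(z + p).fst‖ ≤ 2 * (k * M) := by
        have h4 : (z + p).fst = z.fst + p.fst := rfl
        rw [h4]
        refine (norm_add_le _ _).trans ?_
        have h2 := (ha z hz).2
        have h3 := (norm_fst_le_norm p).trans hp
        linarith
      have h5 := (derivBoundAt_kernelLoss hM (by linarith) hk hΦ w hb h1).2 j hj
      rw [hG]
      refine h5.trans (le_of_eq (by ring)))
    (by
      intro z hz hgood hgrad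
      push Not at hgood
      have h1 := (ha z hz).1
      rw [hG] at hgrad ⊢
      have h2 := lambdaMin_hessian_kernelLoss_le ((hΦ 0).1.of_le (by norm_num))
        (by rw [← hG]; exact hGc.of_le (by norm_num)) hΔ (hpos z) hgood (hgrad.le.trans h1)
      have h3 : η ^ 2 ≤ ‖z.fst‖ ^ 2 := by gcongr
      have h4 : lambdaMin (hessian (kernelLoss Φ w b) z) ≤ -η ^ 2 / (k * d) := by
        rw [le_div_iff₀ (by positivity)]
        linarith
      refine h4.trans (le_of_eq ?_)
      rw [hγ]
      field_simp) hv
  refine ⟨N, out, h1.trans ?_, h2, h3⟩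
  gcongr

end Run

/-! ### Gaussian tails for a target node -/

section GaussianTail

open scoped Matrix

variable {d : ℕ}

lemma multivariateGaussian_smul_one {s : ℝ} (hs : 0 ≤ s) :
    multivariateGaussian (0 : EuclideanSpace ℝ (Fin d)) (s • (1 : Matrix (Fin d) (Fin d) ℝ)) =
      (stdGaussian (EuclideanSpace ℝ (Fin d))).map fun x => √s • x := by
  have : IsFiniteMeasure ((stdGaussian (EuclideanSpace ℝ (Fin d))).map fun x => √s • x) :=
    Measure.isFiniteMeasure_map _ _
  apply Measure.ext_of_charFun
  ext t
  rw [charFun_multivariateGaussian (Matrix.PosSemidef.one.smul hs), charFun_map_smul,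
    charFun_stdGaussian]
  have h : t.ofLp ⬝ᵥ (s • (1 : Matrix (Fin d) (Fin d) ℝ)).mulVec t.ofLp = ‖√s • t‖ ^ 2 := by
    rw [norm_smul, mul_pow, Real.norm_eq_abs, sq_abs, Real.sq_sqrt hs, EuclideanSpace.norm_sq_eq]
    simp only [Matrix.smul_mulVec, Matrix.one_mulVec, dotProduct, Pi.smul_apply, smul_eq_mul,
      Real.norm_eq_abs, sq_abs, Finset.mul_sum]
    exact Finset.sum_congr rfl fun i _ => by ring
  rw [h, inner_zero_right]
  push_cast
  ring_nf

lemma integrable_exp_norm_sq_stdGaussian :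
    Integrable (fun x : EuclideanSpace ℝ (Fin d) => Real.exp (‖x‖ ^ 2 / 4))
      (stdGaussian (EuclideanSpace ℝ (Fin d))) := by
  rw [stdGaussian_eq_withDensity, integrable_withDensity_iff_integrable_smul'
    continuous_gaussianDensity.measurable.ennreal_ofReal (by simp)]
  refine ((integrable_exp_neg_mul_sq_norm (b := 1 / 4) (by norm_num)).const_mul
    ((2 * Real.pi) ^ (-(d / 2 : ℝ)))).congr (Filter.Eventually.of_forall fun x => ?_)
  dsimp only
  rw [ENNReal.toReal_ofReal (gaussianDensity_pos x).le, gaussianDensity, smul_eq_mul,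
    finrank_euclideanSpace_fin, mul_assoc, ← Real.exp_add]
  congr 2
  ring

lemma integral_exp_norm_sq_stdGaussian :
    ∫ x, Real.exp (‖x‖ ^ 2 / 4) ∂(stdGaussian (EuclideanSpace ℝ (Fin d))) = 2 ^ (d / 2 : ℝ) := by
  rw [integral_stdGaussian]
  have h : ∀ x : EuclideanSpace ℝ (Fin d), gaussianDensity x • Real.exp (‖x‖ ^ 2 / 4) =
      (2 * Real.pi) ^ (-(d / 2 : ℝ)) * Real.exp (-(1 / 4) * ‖x‖ ^ 2) := by
    intro x
    simp only [gaussianDensity, smul_eq_mul, finrank_euclideanSpace_fin, mul_assoc,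
      ← Real.exp_add]
    congr 2
    ring
  simp_rw [h]
  rw [integral_const_mul, GaussianFourier.integral_rexp_neg_mul_sq_norm (by norm_num),
    finrank_euclideanSpace_fin, Real.rpow_neg (by positivity), ← Real.inv_rpow (by positivity),
    ← Real.mul_rpow (by positivity) (by positivity)]
  congr 1
  field_simp
  norm_num

/-- Markov's inequality for exp(‖x‖²/4), whose mean 2^(d/2) is weakened to 2^d. -/
lemma stdGaussian_norm_sq_ge (T : ℝ) :
    stdGaussian (EuclideanSpace ℝ (Fin d)) {x | T ≤ ‖x‖ ^ 2} ≤
      ENNReal.ofReal (2 ^ d * Real.exp (-T / 4)) := by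
  have h := mul_meas_ge_le_integral_of_nonneg (μ := stdGaussian (EuclideanSpace ℝ (Fin d)))
    (f := fun x => Real.exp (‖x‖ ^ 2 / 4)) (Filter.Eventually.of_forall fun x => Real.exp_nonneg _)
    integrable_exp_norm_sq_stdGaussian (Real.exp (T / 4))
  rw [integral_exp_norm_sq_stdGaussian] at h
  have h2 : {x : EuclideanSpace ℝ (Fin d) | T ≤ ‖x‖ ^ 2} =
      {x | Real.exp (T / 4) ≤ Real.exp (‖x‖ ^ 2 / 4)} := by
    ext x
    simp only [Set.mem_ofPred_eq, Real.exp_le_exp]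
    constructor <;> intro h <;> linarith
  rw [h2, ← ofReal_measureReal]
  refine ENNReal.ofReal_le_ofReal ?_
  have h3 : (2 : ℝ) ^ (d / 2 : ℝ) ≤ 2 ^ d := by
    rw [← Real.rpow_natCast]
    exact Real.rpow_le_rpow_of_exponent_le (by norm_num) (by
      have : (0 : ℝ) ≤ d := Nat.cast_nonneg d
      linarith)
  rw [neg_div, Real.exp_neg, ← div_eq_mul_inv, le_div_iff₀ (Real.exp_pos _), mul_comm]
  exact h.trans h3

lemma multivariateGaussian_norm_gt {s R : ℝ} (hs : 0 < s) (hR : 0 ≤ R) :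
    multivariateGaussian (0 : EuclideanSpace ℝ (Fin d)) (s • (1 : Matrix (Fin d) (Fin d) ℝ))
      {x | R < ‖x‖} ≤ ENNReal.ofReal (2 ^ d * Real.exp (-(R ^ 2 / s) / 4)) := by
  rw [multivariateGaussian_smul_one hs.le,
    Measure.map_apply (by fun_prop) (measurableSet_lt measurable_const measurable_norm)]
  refine (measure_mono fun x hx => ?_).trans (stdGaussian_norm_sq_ge _)
  simp only [Set.mem_preimage, Set.mem_ofPred_eq, norm_smul, Real.norm_eq_abs,
    abs_of_nonneg (Real.sqrt_nonneg s)] at hx ⊢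
  rw [div_le_iff₀ hs]
  calc R ^ 2 ≤ (√s * ‖x‖) ^ 2 := by gcongr
    _ = ‖x‖ ^ 2 * s := by rw [mul_pow, Real.sq_sqrt hs.le]; ring

end GaussianTail

/-! ### Anticoncentration of a sum with uniform coefficients -/

section SmallBall

instance : IsProbabilityMeasure (ProbabilityTheory.cond volume (Set.Icc (-1 : ℝ) 1)) :=
  cond_isProbabilityMeasure_of_finite (by simp) (by simp)

/-- The event confines x to an interval of length 2S/g, and the uniform density is 1/2. -/
lemma cond_Icc_abs_lt {g r S : ℝ} (hg : 0 < g) :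
    ProbabilityTheory.cond volume (Set.Icc (-1 : ℝ) 1) {x | |x * g + r| < S} ≤
      ENNReal.ofReal (S / g) := by
  have h1 : {x : ℝ | |x * g + r| < S} ⊆ Set.Ioo ((-S - r) / g) ((S - r) / g) := by
    intro x hx
    rw [Set.mem_ofPred_eq, abs_lt] at hx
    constructor
    · rw [div_lt_iff₀ hg]; linarith
    · rw [lt_div_iff₀ hg]; linarith
  refine (measure_mono h1).trans ?_
  rw [cond_apply measurableSet_Icc, Real.volume_Icc]
  refine (mul_le_mul_right (measure_mono Set.inter_subset_right) _).trans ?_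
  rw [Real.volume_Ioo, ← ENNReal.ofReal_inv_of_pos (by norm_num), ← ENNReal.ofReal_mul
      (by norm_num)]
  refine ENNReal.ofReal_le_ofReal (le_of_eq ?_)
  field_simp
  ring

/-- With all coefficients but the first fixed, the others only shift the sum, and the
one-dimensional bound is uniform in the shift. -/
lemma pi_cond_abs_sum_lt {n : ℕ} {c : Fin (n + 1) → ℝ} (hc : 0 < c 0) (S : ℝ) :
    Measure.pi (fun _ : Fin (n + 1) => ProbabilityTheory.cond volume (Set.Icc (-1 : ℝ) 1))
      {b | |∑ j, b j * c j| < S} ≤ ENNReal.ofReal (S / c 0) := by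
  have hm : MeasurableSet {b : Fin (n + 1) → ℝ | |∑ j, b j * c j| < S} :=
    measurableSet_lt (by fun_prop) measurable_const
  have h := (measurePreserving_piFinSuccAbove
    (fun _ : Fin (n + 1) => ProbabilityTheory.cond volume (Set.Icc (-1 : ℝ) 1)) 0).symm
  rw [← h.measure_preimage hm.nullMeasurableSet, Measure.prod_apply_symm (h.measurable hm)]
  refine (lintegral_mono (g := fun _ => ENNReal.ofReal (S / c 0)) fun y => ?_).trans (by simp)
  refine le_of_eq_of_le ?_ (cond_Icc_abs_lt (r := ∑ j, y j * c (Fin.succ j)) (S := S) hc)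
  congr 1
  ext x
  simp [MeasurableEquiv.piFinSuccAbove, Fin.sum_univ_succ]

lemma ae_abs_le_one_cond :
    ∀ᵐ x ∂(ProbabilityTheory.cond volume (Set.Icc (-1 : ℝ) 1)), |x| ≤ 1 := by
  filter_upwards [ae_cond_mem measurableSet_Icc] with x hx
  exact abs_le.2 hx

end SmallBall

/-! ### The probability of a bad target network -/

section TargetLaw

variable {d : ℕ}

/-- A union bound in which a single target node has to lie in the ball of radius R: its own
coefficient supplies the anticoncentration, so the remaining nodes may be anywhere. -/
theorem targetLaw_bad_le {n : ℕ} {s R L S : ℝ} (hs : 0 < s) (hR : 0 ≤ R) (hL : 0 < L) (hS : 0 ≤ S)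
    {Φ : EuclideanSpace ℝ (Fin d) → ℝ} (hΦ : Continuous Φ) (hΦL : ∀ y, ‖y‖ ≤ R → L ≤ Φ y) :
    targetLaw d (n + 1) s
      {t | ¬ ((∀ j, |t.2 j| ≤ 1) ∧ S ≤ |∑ j, t.2 j * Φ (-t.1 j)|)} ≤
      ENNReal.ofReal (2 ^ d * Real.exp (-(R ^ 2 / s) / 4)) + ENNReal.ofReal (S / L) := by
  set μ := Measure.pi fun _ : Fin (n + 1) =>
    multivariateGaussian (0 : EuclideanSpace ℝ (Fin d)) (s • (1 : Matrix (Fin d) (Fin d) ℝ))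
  set ν := Measure.pi fun _ : Fin (n + 1) => ProbabilityTheory.cond volume (Set.Icc (-1 : ℝ) 1)
  have hlaw : targetLaw d (n + 1) s = μ.prod ν := rfl
  rw [hlaw]
  have h1 : (μ.prod ν) {t | R < ‖t.1 0‖} ≤
      ENNReal.ofReal (2 ^ d * Real.exp (-(R ^ 2 / s) / 4)) := by
    have e1 : {t : (Fin (n + 1) → EuclideanSpace ℝ (Fin d)) × (Fin (n + 1) → ℝ) | R < ‖t.1 0‖} =
        Prod.fst ⁻¹' (Function.eval 0 ⁻¹' {x | R < ‖x‖}) := rfl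
    have hm : MeasurableSet {x : EuclideanSpace ℝ (Fin d) | R < ‖x‖} :=
      measurableSet_lt measurable_const measurable_norm
    rw [e1, measurePreserving_fst.measure_preimage
      ((measurable_pi_apply 0) hm).nullMeasurableSet,
      (measurePreserving_eval _ 0).measure_preimage hm.nullMeasurableSet]
    exact multivariateGaussian_norm_gt hs hR
  have h2 : (μ.prod ν) {t | ¬ ∀ j, |t.2 j| ≤ 1} = 0 := by
    have : ∀ᵐ b ∂ν, ∀ j, |b j| ≤ 1 := by
      rw [ae_all_iff]
      intro j
      exact (measurePreserving_eval (fun _ : Fin (n + 1) =>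
        ProbabilityTheory.cond volume (Set.Icc (-1 : ℝ) 1)) j).quasiMeasurePreserving.ae
        ae_abs_le_one_cond
    exact (measurePreserving_snd (μ := μ) (ν := ν)).quasiMeasurePreserving.ae this
  have h3 : (μ.prod ν) {t | ‖t.1 0‖ ≤ R ∧ |∑ j, t.2 j * Φ (-t.1 j)| < S} ≤
      ENNReal.ofReal (S / L) := by
    have hΦm := hΦ.measurable
    have hm : MeasurableSet {t : (Fin (n + 1) → EuclideanSpace ℝ (Fin d)) × (Fin (n + 1) → ℝ) |
        ‖t.1 0‖ ≤ R ∧ |∑ j, t.2 j * Φ (-t.1 j)| < S} := by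
      rw [Set.ofPred_and]
      exact (measurableSet_le (by fun_prop) measurable_const).inter
        (measurableSet_lt (by fun_prop) measurable_const)
    rw [Measure.prod_apply hm]
    refine (lintegral_mono (g := fun _ => ENNReal.ofReal (S / L)) fun w => ?_).trans (by simp)
    by_cases hw : ‖w 0‖ ≤ R
    · have hL' : L ≤ Φ (-w 0) := hΦL _ (by rwa [norm_neg])
      refine (measure_mono fun b hb => hb.2).trans
        ((pi_cond_abs_sum_lt (c := fun j => Φ (-w j)) (hL.trans_le hL') S).trans ?_)
      exact ENNReal.ofReal_le_ofReal (div_le_div_of_nonneg_left hS hL hL')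
    · simp [hw]
  have hsub : {t : (Fin (n + 1) → EuclideanSpace ℝ (Fin d)) × (Fin (n + 1) → ℝ) |
      ¬ ((∀ j, |t.2 j| ≤ 1) ∧ S ≤ |∑ j, t.2 j * Φ (-t.1 j)|)} ⊆
      ({t | R < ‖t.1 0‖} ∪ {t | ¬ ∀ j, |t.2 j| ≤ 1}) ∪
        {t | ‖t.1 0‖ ≤ R ∧ |∑ j, t.2 j * Φ (-t.1 j)| < S} := by
    intro t ht
    simp only [Set.mem_ofPred_eq, Set.mem_union, not_and_or, not_le] at ht ⊢
    rcases ht with ht | ht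
    · exact Or.inl (Or.inr ht)
    · rcases lt_or_ge R ‖t.1 0‖ with h | h
      · exact Or.inl (Or.inl h)
      · exact Or.inr ⟨h, ht⟩
  calc (μ.prod ν) _ ≤ _ := measure_mono hsub
    _ ≤ _ := measure_union_le _ _
    _ ≤ _ := add_le_add_left (measure_union_le _ _) _
    _ ≤ _ := by rw [h2, add_zero]; exact add_le_add h1 h3

end TargetLaw

/-! ### Bookkeeping of exponents -/

section Numerics

/-- With all the parameters polynomial in `X`, the iteration bound is polynomial in `X`. -/
lemma iteration_bound_le_pow {X : ℝ} (hX : 3 ≤ X) {k d M S₀ α η γ : ℝ} {p m s : ℕ} (hk : 1 ≤ k)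
    (hkX : k ≤ X ^ p) (hd : 1 ≤ d) (hdX : d ≤ X) (hM : M = X ^ m) (hS₀ : S₀ = (X ^ s)⁻¹)
    (hα : α = 1 / (2 * (4000 * k ^ 4 * M ^ 3))) (hη : η = S₀ ^ 2 / (4 * k ^ 2 * M))
    (hγ : γ = η ^ 2 / (2 * k * d)) :
    k ^ 2 * M / min (α * η ^ 2 / 2) (α ^ 2 * γ ^ 3 / 2) + 1 ≤
      X ^ (2 * p + m + (2 * (9 + 4 * p + 3 * m) +
        3 * (2 * (2 * s + (2 + 2 * p + m)) + (p + 2)) + 1) + 1) := by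
  have hX0 : 0 < X := by linarith
  have hX1 : 1 ≤ X := by linarith
  have hM0 : 0 < M := by rw [hM]; positivity
  -- The exponents e, f and g are chosen so that η, α and γ are at least X^(-e), X^(-f) and X^(-g).
  set e := 2 * s + (2 + 2 * p + m)
  set f := 9 + 4 * p + 3 * m
  set g := 2 * e + (p + 2)
  have h1 : (X ^ e)⁻¹ ≤ η := by
    rw [hη, hS₀, inv_pow, ← pow_mul, inv_eq_one_div, inv_eq_one_div, div_div]
    refine one_div_le_one_div_of_le (by positivity) ?_
    calc X ^ (s * 2) * (4 * k ^ 2 * M) ≤ X ^ (s * 2) * (X ^ 2 * (X ^ p) ^ 2 * X ^ m) := by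
          rw [hM]
          gcongr
          nlinarith
      _ = X ^ e := by simp only [e]; ring
  have h2 : (X ^ f)⁻¹ ≤ α := by
    rw [hα, inv_eq_one_div]
    refine one_div_le_one_div_of_le (by positivity) ?_
    calc 2 * (4000 * k ^ 4 * M ^ 3) = 8000 * k ^ 4 * M ^ 3 := by ring
      _ ≤ X ^ 9 * (X ^ p) ^ 4 * (X ^ m) ^ 3 := by
          rw [hM]
          gcongr
          calc (8000 : ℝ) ≤ 3 ^ 9 := by norm_num
            _ ≤ X ^ 9 := by gcongr
      _ = X ^ f := by simp only [f]; ring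
  have h3 : (X ^ g)⁻¹ ≤ γ := by
    calc (X ^ g)⁻¹ = ((X ^ e)⁻¹) ^ 2 / (X * X ^ p * X) := by
          simp only [g]
          field_simp
          ring
      _ ≤ γ := by
          rw [hγ]
          gcongr
          linarith
  have hη0 : 0 < η := lt_of_lt_of_le (by positivity) h1
  have hα0 : 0 < α := lt_of_lt_of_le (by positivity) h2
  have hγ0 : 0 < γ := lt_of_lt_of_le (by positivity) h3
  -- The final 1 absorbs the factor 1/2. One exponent serves both terms of the minimum because g ≥
  -- 2e.
  have h4 : (X ^ (2 * f + 3 * g + 1))⁻¹ ≤ min (α * η ^ 2 / 2) (α ^ 2 * γ ^ 3 / 2) := by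
    refine le_min ?_ ?_
    · calc (X ^ (2 * f + 3 * g + 1))⁻¹ ≤ (X ^ (f + 2 * e + 1))⁻¹ := by
            refine inv_anti₀ (by positivity) (pow_le_pow_right₀ hX1 ?_)
            simp only [g]
            omega
        _ = (X ^ f)⁻¹ * ((X ^ e)⁻¹) ^ 2 / X := by field_simp; ring
        _ ≤ α * η ^ 2 / 2 := by gcongr; linarith
    · calc (X ^ (2 * f + 3 * g + 1))⁻¹ = ((X ^ f)⁻¹) ^ 2 * ((X ^ g)⁻¹) ^ 3 / X := by
            field_simp; ring
        _ ≤ α ^ 2 * γ ^ 3 / 2 := by gcongr; linarith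
  have h5 : k ^ 2 * M / min (α * η ^ 2 / 2) (α ^ 2 * γ ^ 3 / 2) ≤
      X ^ (2 * p + m + (2 * f + 3 * g + 1)) := by
    calc k ^ 2 * M / min (α * η ^ 2 / 2) (α ^ 2 * γ ^ 3 / 2)
        ≤ (X ^ p) ^ 2 * X ^ m / (X ^ (2 * f + 3 * g + 1))⁻¹ := by
          rw [hM]
          rw [hM] at hM0
          gcongr
      _ = X ^ (2 * p + m + (2 * f + 3 * g + 1)) := by
          rw [div_inv_eq_mul]
          ring
  have h6 : 1 ≤ X ^ (2 * p + m + (2 * f + 3 * g + 1)) := one_le_pow₀ hX1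
  rw [pow_succ X (2 * p + m + (2 * f + 3 * g + 1))]
  nlinarith

variable {d : ℕ} {ε : ℝ}

lemma three_lt_div (hd : 3 ≤ d) (hε : 0 < ε) (hε1 : ε < 1) : 3 < (d : ℝ) / ε := by
  have : (3 : ℝ) ≤ d := by exact_mod_cast hd
  rw [lt_div_iff₀ hε]
  linarith

lemma natCast_le_div (hε : 0 < ε) (hε1 : ε < 1) : (d : ℝ) ≤ d / ε := by
  rw [le_div_iff₀ hε]
  exact mul_le_of_le_one_right (Nat.cast_nonneg d) hε1.le

lemma one_le_log_natCast (hd : 3 ≤ d) : 1 ≤ Real.log d := by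
  rw [Real.le_log_iff_exp_le (by positivity)]
  have : (3 : ℝ) ≤ d := by exact_mod_cast hd
  have := Real.exp_one_lt_d9
  linarith

lemma natCast_le_pow_of_three_le {B : ℝ} (hB : 3 ≤ B) (n : ℕ) : (n : ℝ) ≤ B ^ n := by
  calc (n : ℝ) ≤ 3 ^ n := by exact_mod_cast (Nat.lt_pow_self (by norm_num)).le
    _ ≤ B ^ n := by gcongr

/-- The kernel is at least `(d / ε)^(-O(d))` on a ball of radius `O(d log d)`. -/
lemma besselKernel_ge_pow (hd : 3 ≤ d) (hε : 0 < ε) (hε1 : ε < 1) {m : ℕ} (hm : 1 ≤ m)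
    {y : EuclideanSpace ℝ (Fin d)} (hy : ‖y‖ + 1 ≤ m * (d * Real.log d)) :
    ((((d : ℝ) / ε) ^ d) ^ (34 * m + 9))⁻¹ ≤ besselKernel ε y := by
  set B := (d : ℝ) / ε
  have hd3 : (3 : ℝ) ≤ d := by exact_mod_cast hd
  have hB3 : 3 ≤ B := (three_lt_div hd hε hε1).le
  have hB0 : 0 < B := by linarith
  have hdB : (d : ℝ) ≤ B := natCast_le_div hε hε1
  have hl := one_le_log_natCast hd
  have hl2 : Real.log d ≤ d := (Real.log_le_sub_one_of_pos (by linarith)).trans (by linarith)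
  have hm' : (1 : ℝ) ≤ m := by exact_mod_cast hm
  have hR : 1 ≤ m * (d * Real.log d) := by linarith [norm_nonneg y]
  refine le_trans ?_ (besselKernel_ge (by omega) hε hε1 hR hy)
  have h1 : B⁻¹ ≤ 2 / d := by
    rw [inv_eq_one_div, div_le_div_iff₀ hB0 (by linarith)]
    linarith
  have h2 : (B ^ (13 * m + 2))⁻¹ ≤ 1 / (13 * (m * (d * Real.log d))) := by
    rw [inv_eq_one_div]
    refine one_div_le_one_div_of_le (by positivity) ?_
    have h := natCast_le_pow_of_three_le hB3 (13 * m)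
    push_cast at h
    calc 13 * (m * (d * Real.log d)) = 13 * m * (d * Real.log d) := by ring
      _ ≤ B ^ (13 * m) * (B * B) := by
          gcongr
          exact hl2.trans hdB
      _ = B ^ (13 * m + 2) := by ring
  have h3 : (B ^ (4 * m * d))⁻¹ ≤ Real.exp (-4 * (m * (d * Real.log d))) := by
    have h4 : Real.exp (-4 * (m * (d * Real.log d))) = ((d : ℝ) ^ (4 * m * d))⁻¹ := by
      rw [← Real.exp_log (show (0 : ℝ) < d by linarith), ← Real.exp_nat_mul, ← Real.exp_neg,
        Real.log_exp]
      congr 1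
      push_cast
      rw [Real.exp_log (by linarith)]
      ring
    rw [h4]
    gcongr
  have h5 : (B ^ 2)⁻¹ ≤ 2 * ε / (5 * d) := by
    have h6 : 2 * ε / (5 * d) = (5 / 2 * B)⁻¹ := by
      simp only [B]
      field_simp
    rw [h6]
    refine inv_anti₀ (by positivity) ?_
    nlinarith
  -- The exponent is 1 + 2((13m + 2) + 4m + 2) = 34m + 9, from `h1` and the square of the product of
  -- `h2`, `h3` and `h5`.
  calc ((B ^ d) ^ (34 * m + 9))⁻¹
      = (B⁻¹) ^ d * (((B ^ (13 * m + 2))⁻¹) ^ d * (B ^ (4 * m * d))⁻¹ * ((B ^ 2)⁻¹) ^ d) ^ 2 := by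
        simp only [inv_pow, ← pow_mul, ← mul_inv, ← pow_add]
        congr 2
        ring
    _ ≤ _ := by gcongr

end Numerics

/-! ### Failure probabilities in terms of d^(-q) -/

section Main

variable {d : ℕ} {ε : ℝ}

/-- Let D = d log d. A radius mD against a variance s ≤ cD gives the tail exponent -(2 + |q|)D; the
part 2D absorbs 2^(d+1), and |q|D ≥ q log d yields d^(-q). -/
lemma two_pow_mul_exp_le (hd : 3 ≤ d) {q c s : ℝ} {m : ℕ} (hs : 0 < s)
    (hsc : s ≤ c * (d * Real.log d)) (hm : 1 ≤ m) (hmc : 4 * (2 + |q|) * c ≤ m) :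
    2 ^ d * Real.exp (-((m * (d * Real.log d)) ^ 2 / s) / 4) ≤ (d : ℝ) ^ (-q) / 2 := by
  have hl := one_le_log_natCast hd
  have hd3 : (3 : ℝ) ≤ d := by exact_mod_cast hd
  have hm' : (1 : ℝ) ≤ m := by exact_mod_cast hm
  set D := (d : ℝ) * Real.log d with hD
  have hD1 : (d : ℝ) ≤ D := le_mul_of_one_le_right (by linarith) hl
  have hDl : Real.log d ≤ D := le_mul_of_one_le_left (by linarith) (by linarith)
  have hq := abs_nonneg q
  have h1 : 4 * (2 + |q|) * D ≤ (m * D) ^ 2 / s := by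
    rw [le_div_iff₀ hs]
    calc 4 * (2 + |q|) * D * s ≤ 4 * (2 + |q|) * D * (c * D) := by gcongr
      _ = 4 * (2 + |q|) * c * D ^ 2 := by ring
      _ ≤ m * D ^ 2 := by gcongr
      _ ≤ m * D ^ 2 * m := le_mul_of_one_le_right (by positivity) hm'
      _ = (m * D) ^ 2 := by ring
  have h2 : (2 : ℝ) ^ (d + 1) ≤ Real.exp (2 * D) := by
    calc (2 : ℝ) ^ (d + 1) ≤ Real.exp 1 ^ (d + 1) := by
          gcongr
          have := Real.exp_one_gt_d9
          linarith
      _ = Real.exp (d + 1) := by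
          rw [← Real.exp_nat_mul]
          push_cast
          ring_nf
      _ ≤ Real.exp (2 * D) := Real.exp_le_exp.2 (by linarith)
  have h3 : (d : ℝ) ^ (-q) = Real.exp (-(q * Real.log d)) := by
    rw [Real.rpow_def_of_pos (by linarith)]
    ring_nf
  have h4 : q * Real.log d ≤ |q| * D :=
    (mul_le_mul_of_nonneg_right (le_abs_self q) (by linarith)).trans
      (mul_le_mul_of_nonneg_left hDl hq)
  rw [le_div_iff₀ two_pos, h3]
  calc 2 ^ d * Real.exp (-((m * D) ^ 2 / s) / 4) * 2
      = 2 ^ (d + 1) * Real.exp (-((m * D) ^ 2 / s) / 4) := by ring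
    _ ≤ Real.exp (2 * D) * Real.exp (-(4 * (2 + |q|) * D) / 4) := by gcongr
    _ = Real.exp (-(|q| * D)) := by rw [← Real.exp_add]; ring_nf
    _ ≤ Real.exp (-(q * Real.log d)) := Real.exp_le_exp.2 (by linarith)

lemma inv_pow_le_rpow_neg (hd : 3 ≤ d) {X : ℝ} (hX : (d : ℝ) ≤ X) (q : ℝ) :
    (X ^ (⌈|q|⌉₊ + 1))⁻¹ ≤ (d : ℝ) ^ (-q) / 2 := by
  have hd3 : (3 : ℝ) ≤ d := by exact_mod_cast hd
  rw [pow_succ, mul_inv, div_eq_mul_inv, Real.rpow_neg (by linarith)]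
  have h1 : (d : ℝ) ^ q ≤ X ^ ⌈|q|⌉₊ := by
    calc (d : ℝ) ^ q ≤ (d : ℝ) ^ (⌈|q|⌉₊ : ℝ) :=
          Real.rpow_le_rpow_of_exponent_le (by linarith) ((le_abs_self q).trans (Nat.le_ceil _))
      _ = (d : ℝ) ^ ⌈|q|⌉₊ := Real.rpow_natCast _ _
      _ ≤ X ^ ⌈|q|⌉₊ := by gcongr
  have h2 : 0 < (d : ℝ) ^ q := Real.rpow_pos_of_pos (by linarith) _
  have h3 : 0 < X := by linarith
  exact mul_le_mul (inv_anti₀ h2 h1) (inv_anti₀ two_pos (by linarith)) (by positivity)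
    (by positivity)

end Main

end

/-- The failure event is bounded as a set of outer measure, so its measurability is never at issue:
it is contained in the bad event of `targetLaw_bad_le`. -/
theorem mainTheorem2 :
    ∃ σ : (d k : ℕ) → ℝ → EuclideanSpace ℝ (Fin d) → EuclideanSpace ℝ (Fin d) → ℝ,
      (∀ (d k : ℕ) (ε : ℝ), d % 4 = 3 → 1 ≤ k → 0 < ε → ε < 1 →
        IsAlmostHarmonicActivation ε (σ d k ε)) ∧
      ∀ (p : ℕ) (c q : ℝ), ∃ C : ℕ, ∀ (d k : ℕ) (ε s : ℝ),
        d % 4 = 3 → 1 ≤ k → k ≤ d ^ p → 0 < ε → ε < 1 → 0 < s → s ≤ c * (d * Real.log d) →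
        ∃ α η γ : ℝ, 0 < α ∧ 0 < η ∧ 0 < γ ∧
          ∃ θ₀ : Fin k → EuclideanSpace ℝ (Fin d),
            targetLaw d k s
              {t | ¬ ∃ a₀ : Fin k → ℝ,
                ∀ v : Params d k → Params d k,
                  IsMinEigenvectorRule (regLoss (σ d k ε) t.1 t.2) v →
                  ∃ (N : ℕ) (out : Params d k),
                    (N : ℝ) ≤ ((d : ℝ) / ε) ^ (C * d) ∧
                    SecondGDReturns (regLoss (σ d k ε) t.1 t.2) v α η γ
                      (mkParams a₀ θ₀) N out ∧
                    ∃ i j : Fin k, ‖out.snd i - t.1 j‖ < ε} ≤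
              ENNReal.ofReal ((d : ℝ) ^ (-q)) := by
  refine ⟨fun d _ ε => harmonicActivation d ε, fun d k ε hd _ hε hε1 =>
    isAlmostHarmonicActivation_harmonicActivation (by omega) hε hε1, fun p c q => ?_⟩
  obtain ⟨A, hA1, hA⟩ := exists_normalizedKernel_bound
  -- With X = (d/ε)^d and D = d log d: rD is the radius for the target node, X^(-n) the lower bound
  -- for the kernel on that ball, X^m the bound for the derivatives of the potential, and X^(-e) the
  -- threshold for |S|. The surplus of e over n makes the small ball probability at most d^(-q)/2.
  set r := ⌈4 * (2 + |q|) * c⌉₊ + 1 with hr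
  set n := 34 * (r + 1) + 9
  set m := n + ⌈A⌉₊ + 3 with hm
  set e := n + (⌈|q|⌉₊ + 1) with he
  refine ⟨2 * p + m + (2 * (9 + 4 * p + 3 * m) +
    3 * (2 * (2 * e + (2 + 2 * p + m)) + (p + 2)) + 1) + 1, fun d k ε s hd4 hk hkd hε hε1 hs hsc =>
        ?_⟩
  have hd : 3 ≤ d := by omega
  have hd3 : (3 : ℝ) ≤ d := by exact_mod_cast hd
  have hk' : (1 : ℝ) ≤ k := by exact_mod_cast hk
  have hl := one_le_log_natCast hd
  set D := (d : ℝ) * Real.log d with hD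
  have hD1 : 1 ≤ D := by nlinarith
  set X := ((d : ℝ) / ε) ^ d with hX
  have hB3 := (three_lt_div hd hε hε1).le
  have hBX : (d : ℝ) / ε ≤ X := le_self_pow₀ (by linarith) (by omega)
  have hX3 : 3 ≤ X := hB3.trans hBX
  have hX0 : 0 < X := by linarith
  have hdX : (d : ℝ) ≤ X := (natCast_le_div hε hε1).trans hBX
  -- Passing from r to r + 1 makes room for the additive 1 in `besselKernel_ge_pow`, as D ≥ 1.
  have hker : ∀ y : EuclideanSpace ℝ (Fin d), ‖y‖ ≤ r * D → (X ^ n)⁻¹ ≤ besselKernel ε y :=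
    fun y hy => besselKernel_ge_pow hd hε hε1 (m := r + 1) (by omega) (by push_cast; linarith)
  have hker0 : (besselKernel ε (0 : EuclideanSpace ℝ (Fin d)))⁻¹ ≤ X ^ n := by
    have h := hker 0 (by rw [norm_zero]; positivity)
    exact inv_le_of_inv_le₀ (by positivity) h
  have hΦ : ∀ x : EuclideanSpace ℝ (Fin d), DerivBoundAt (normalizedKernel d ε) x (X ^ m) := by
    refine fun x => ⟨contDiff_normalizedKernel hε hε1, fun j hj => (hA d ε hε hε1 j hj x).trans ?_⟩
    calc (besselKernel ε (0 : EuclideanSpace ℝ (Fin d)))⁻¹ * (A / ε ^ 3)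
        ≤ X ^ n * (X ^ ⌈A⌉₊ * X ^ 3) := by
          have h1 : A ≤ X ^ ⌈A⌉₊ :=
            (Nat.le_ceil A).trans (natCast_le_pow_of_three_le hX3 _)
          have h2 : ε⁻¹ ≤ X := by
            refine le_trans ?_ hBX
            rw [inv_eq_one_div]
            gcongr
            linarith
          rw [div_eq_mul_inv, ← inv_pow]
          gcongr
      _ = X ^ m := by rw [hm]; ring
  have hM : 1 ≤ X ^ m := one_le_pow₀ (by linarith)
  obtain ⟨α, hα⟩ : ∃ α : ℝ, α = 1 / (2 * (4000 * k ^ 4 * (X ^ m) ^ 3)) := ⟨_, rfl⟩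
  obtain ⟨η, hη⟩ : ∃ η : ℝ, η = ((X ^ e)⁻¹) ^ 2 / (4 * k ^ 2 * X ^ m) := ⟨_, rfl⟩
  obtain ⟨γ, hγ⟩ : ∃ γ : ℝ, γ = η ^ 2 / (2 * k * d) := ⟨_, rfl⟩
  have hα0 : 0 < α := by rw [hα]; positivity
  have hη0 : 0 < η := by rw [hη]; positivity
  have hγ0 : 0 < γ := by rw [hγ]; positivity
  -- All nodes start at the origin; only the initial weights depend on the target.
  refine ⟨α, η, γ, hα0, hη0, hγ0, fun _ => 0, ?_⟩
  obtain ⟨k', rfl⟩ : ∃ k', k = k' + 1 := ⟨k - 1, by omega⟩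
  have hkX : ((k' + 1 : ℕ) : ℝ) ≤ X ^ p := by
    calc ((k' + 1 : ℕ) : ℝ) ≤ (d : ℝ) ^ p := by exact_mod_cast hkd
      _ ≤ X ^ p := by gcongr
  have hbad := targetLaw_bad_le (d := d) (n := k') (R := r * D) (L := (X ^ n)⁻¹) (S := (X ^ e)⁻¹) hs
    (by positivity) (by positivity) (by positivity) (contDiff_normalizedKernel hε hε1).continuous
    (fun y hy => by
      refine (hker y hy).trans (le_mul_of_one_le_left (besselKernel_nonneg y) ?_)
      exact (one_le_inv₀ (besselKernel_zero_pos (by omega) hε hε1)).2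
        (besselKernel_le_one hε hε1 0))
  refine le_trans (measure_mono ?_) (hbad.trans ?_)
  · intro t ht hgood
    refine ht ?_
    obtain ⟨a₀, h⟩ := exists_secondGD_run (d := d) (by omega) hk hM hΦ
      (normalizedKernel_zero (by omega) hε hε1)
      (fun y hy => laplacian_normalizedKernel hε hε1 hy) (memLp_harmonicActivation hε)
      potential_harmonicActivation (by positivity) hgood.1 hgood.2 hα hη hγ
    refine ⟨a₀, fun v hv => ?_⟩
    obtain ⟨N, out, h1, h2, h3⟩ := h v hv
    refine ⟨N, out, h1.trans ?_, h2, h3⟩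
    rw [pow_mul' ((d : ℝ) / ε)]
    exact iteration_bound_le_pow hX3 hk' hkX (by linarith) hdX rfl rfl hα hη hγ
  · rw [← ENNReal.ofReal_add (by positivity) (by positivity)]
    refine ENNReal.ofReal_le_ofReal ?_
    have h1 := two_pow_mul_exp_le hd (q := q) hs hsc (m := r) (by omega)
      ((Nat.le_ceil _).trans (by rw [hr]; push_cast; linarith))
    -- The Gaussian tail and the small ball event each receive half of d^(-q).
    have h2 : (X ^ e)⁻¹ / (X ^ n)⁻¹ = (X ^ (⌈|q|⌉₊ + 1))⁻¹ := by
      rw [he, pow_add]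
      field_simp
    have h3 := inv_pow_le_rpow_neg hd hdX q
    rw [h2]
    linarith
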